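/- Let $R$ be a left and right Noetherian ring and let $A$ be a finitely generated left $R$-module. Write $(-)^*=\operatorname{Hom}(-,R)$. Definitions. - A module $G$ (not necessarily finitely generated) over a ring $S$ is *Gorenstein projective* if it is isomorphic to the image $\operatorname{Im}(P_0\to P^0)$ in an exact sequence of projective $S$-modules $\cdots\to P_1\to P_0\to P^0\to P^1\to\cdots$ that remains exact under $\operatorname{Hom}_S(-,Q)$ for every projective $S$-module $Q$. The *Gorenstein projective dimension* $\operatorname{Gpd}_S(M)\in\{0,1,2,\dots\}\cup\{\infty\}$ of an $S$-module $M$ is the infimum of the $n\ge 0$ for which there is an exact sequence $0\to G_n\to\cdots\to G_1\to G_0\to M\to 0$ of $S$-modules with all $G_i$ Gorenstein projective; in particular $\operatorname{Gpd}_S(0)=0$. - A *transpose* of $A$ is any right $R$-module isomorphic to $\operatorname{Coker}(f^*\colon P_0^*\to P_1^*)$ for some exact sequence $P_1\xrightarrow{f}P_0\to A\to 0$ with $P_0,P_1$ finitely generated projective. A *Gorenstein transpose* of $A$ is any right $R$-module isomorphic to $\operatorname{Coker}(g^*\colon X_0^*\to X_1^*)$ for some exact sequence $X_1\xrightarrow{g}X_0\to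 A\to 0$ with $X_0,X_1$ finitely generated Gorenstein projective. Transposes of finitely generated right $R$-modules, which are left $R$-modules, are defined in the same way. - For $n\ge 1$, a finitely generated right $R$-module $M$ is *$n$-torsionfree* if $\operatorname{Ext}^i_R(B,R)=0$ for all $1\le i\le n$ and every transpose $B$ of $M$. **Proposition 3.4.** For every Gorenstein transpose $M$ of $A$ and every transpose $N$ of $A$: (1) $\operatorname{Ext}^i_{R^{op}}(M,R)\cong\operatorname{Ext}^i_{R^{op}}(N,R)$ as left $R$-modules, for every $i\ge 1$. (2) For every $n\ge 1$, $M$ is $n$-torsionfree if and only if $N$ is $n$-torsionfree. (4) $\operatorname{Gpd}_{R^{op}}(M)=\operatorname{Gpd}_{R^{op}}(N)$. Moreover: (3) The following are equivalent: (a) some Gorenstein transpose of $A$ is zero; (b) $A$ is Gorenstein projective; (c) every Gorenstein transpose of $A$ is Gorenstein projective; (d) every transpose of $A$ is Gorenstein projective. -/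

import Mathlib

open CategoryTheory

universe u

/-
Right `R`-modules are modules over `Rᵐᵒᵖ`.  The notions below that involve the dual `Hom(-, R)` are
stated for a ring `S`, a ring `T` and an abelian group `D` with commuting actions of `S` and `T`,
so that `Hom_S(X, D)` is a `T`-module for every `S`-module `X`.  They are used in two cases only:
* `S = R`, `T = Rᵐᵒᵖ`, `D = R`: duals of left `R`-modules, which are right `R`-modules;
* `S = Rᵐᵒᵖ`, `T = R`, `D = R`: duals of right `R`-modules, which are left `R`-modules.
-/

/-- `G` is a Gorenstein projective `S`-module: it is isomorphic to the image of a differential of an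
exact sequence `⋯ → P i → P (i + 1) → ⋯` (`i ∈ ℤ`) of projective `S`-modules, not necessarily
finitely generated, that remains exact under `Hom_S(-, Q)` for all projective `Q`. -/
def IsGorensteinProjective (S : Type u) [Ring S] (G : Type u) [AddCommGroup G] [Module S G] :
    Prop :=
  ∃ (P : ℤ → ModuleCat.{u} S) (d : ∀ i : ℤ, P i →ₗ[S] P (i + 1)),
    (∀ i, Module.Projective S (P i)) ∧
    (∀ i, Function.Exact (d i) (d (i + 1))) ∧
    (∀ Q : ModuleCat.{u} S, Module.Projective S Q → ∀ i,
      Function.Exact (fun φ : P (i + 1 + 1) →ₗ[S] Q => φ ∘ₗ d (i + 1))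
        (fun φ : P (i + 1) →ₗ[S] Q => φ ∘ₗ d i)) ∧
    Nonempty (G ≃ₗ[S] LinearMap.range (d 0))

/-- There is an exact sequence `0 → G n → ⋯ → G 1 → G 0 → M → 0` of `S`-modules with all `G i`
Gorenstein projective (the sequence is continued by zero modules beyond `G n`). -/
def HasGorensteinProjectiveResolution (S : Type u) [Ring S] (M : Type u) [AddCommGroup M]
    [Module S M] (n : ℕ) : Prop :=
  ∃ (G : ℕ → ModuleCat.{u} S) (d : ∀ i : ℕ, G (i + 1) →ₗ[S] G i) (ε : G 0 →ₗ[S] M),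
    (∀ i, IsGorensteinProjective S (G i)) ∧
    (∀ i, n < i → Subsingleton (G i)) ∧
    Function.Surjective ε ∧
    Function.Exact (d 0) ε ∧
    (∀ i, Function.Exact (d (i + 1)) (d i))

/-- The Gorenstein projective dimension of `M`: the infimum of the lengths of its resolutions by
Gorenstein projective modules, and `⊤` if there is none. The zero module has dimension `0`. -/
noncomputable def gorensteinProjectiveDim (S : Type u) [Ring S] (M : Type u) [AddCommGroup M]
    [Module S M] : ℕ∞ :=
  sInf {k : ℕ∞ | ∃ n : ℕ, k = n ∧ HasGorensteinProjectiveResolution S M n}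

section Transpose

variable (S T D : Type u) [Ring S] [Ring T] [AddCommGroup D] [Module S D] [Module T D]
  [SMulCommClass S T D]

/-- `M` is (isomorphic to) a transpose of the `S`-module `A`: the cokernel of
`f^* : Hom_S(P₀, D) → Hom_S(P₁, D)` for an exact sequence `P₁ --f→ P₀ → A → 0` with `P₀`, `P₁`
finitely generated projective. -/
def IsTranspose (A : Type u) [AddCommGroup A] [Module S A]
    (M : Type u) [AddCommGroup M] [Module T M] : Prop :=
  ∃ (P₁ P₀ : ModuleCat.{u} S) (f : P₁ →ₗ[S] P₀) (p : P₀ →ₗ[S] A),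
    Module.Finite S P₁ ∧ Module.Finite S P₀ ∧
    Module.Projective S P₁ ∧ Module.Projective S P₀ ∧
    Function.Exact f p ∧ Function.Surjective p ∧
    Nonempty (M ≃ₗ[T] ((P₁ →ₗ[S] D) ⧸ LinearMap.range (LinearMap.lcomp T D f)))

/-- `M` is (isomorphic to) a Gorenstein transpose of the `S`-module `A`: the cokernel of
`g^* : Hom_S(X₀, D) → Hom_S(X₁, D)` for an exact sequence `X₁ --g→ X₀ → A → 0` with `X₀`, `X₁`
finitely generated Gorenstein projective. -/
def IsGorensteinTranspose (A : Type u) [AddCommGroup A] [Module S A]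
    (M : Type u) [AddCommGroup M] [Module T M] : Prop :=
  ∃ (X₁ X₀ : ModuleCat.{u} S) (g : X₁ →ₗ[S] X₀) (p : X₀ →ₗ[S] A),
    Module.Finite S X₁ ∧ Module.Finite S X₀ ∧
    IsGorensteinProjective S X₁ ∧ IsGorensteinProjective S X₀ ∧
    Function.Exact g p ∧ Function.Surjective p ∧
    Nonempty (M ≃ₗ[T] ((X₁ →ₗ[S] D) ⧸ LinearMap.range (LinearMap.lcomp T D g)))

/-- The group `Ext_S^i(M, D)`. -/
abbrev ExtGroup (M : Type u) [AddCommGroup M] [Module S M] (i : ℕ) : Type u :=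
  Abelian.Ext (ModuleCat.of S M) (ModuleCat.of S D) i

/-- Multiplication by `t : T` on `D`, as an endomorphism of the `S`-module `D`. -/
def scalarEnd [SMulCommClass T S D] (t : T) : ModuleCat.of S D ⟶ ModuleCat.of S D :=
  ModuleCat.ofHom (Module.toModuleEnd S D t)

/-- `Ext_S^i(M, D)` is a `T`-module, through the action of `T` on `D`. -/
@[reducible]
noncomputable def extModule (M : Type u) [AddCommGroup M] [Module S M]
    [SMulCommClass T S D] (i : ℕ) :
    Module T (ExtGroup S D M i) where
  smul t x := x.comp (Abelian.Ext.mk₀ (scalarEnd S T D t)) (add_zero i)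
  one_smul x := by
    change x.comp (Abelian.Ext.mk₀ (scalarEnd S T D 1)) (add_zero i) = x
    have h : scalarEnd S T D 1 = 𝟙 _ := by
      unfold scalarEnd; rw [map_one]; rfl
    rw [h, Abelian.Ext.comp_mk₀_id]
  mul_smul s t x := by
    change x.comp (Abelian.Ext.mk₀ (scalarEnd S T D (s * t))) (add_zero i) =
      (x.comp (Abelian.Ext.mk₀ (scalarEnd S T D t)) (add_zero i)).comp
        (Abelian.Ext.mk₀ (scalarEnd S T D s)) (add_zero i)
    have h : scalarEnd S T D (s * t) = scalarEnd S T D t ≫ scalarEnd S T D s := by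
      unfold scalarEnd; rw [map_mul]; rfl
    rw [h, ← Abelian.Ext.mk₀_comp_mk₀, Abelian.Ext.comp_assoc_of_third_deg_zero]
  smul_zero t := by
    change (0 : ExtGroup S D M i).comp (Abelian.Ext.mk₀ (scalarEnd S T D t)) (add_zero i) = 0
    rw [Abelian.Ext.zero_comp]
  smul_add t x y := Abelian.Ext.add_comp _ _ _ _
  add_smul s t x := by
    change x.comp (Abelian.Ext.mk₀ (scalarEnd S T D (s + t))) (add_zero i) =
      x.comp (Abelian.Ext.mk₀ (scalarEnd S T D s)) (add_zero i) +
        x.comp (Abelian.Ext.mk₀ (scalarEnd S T D t)) (add_zero i)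
    have h : scalarEnd S T D (s + t) = scalarEnd S T D s + scalarEnd S T D t := by
      unfold scalarEnd; rw [map_add]; rfl
    rw [h, Abelian.Ext.mk₀_add, Abelian.Ext.comp_add]
  zero_smul x := by
    change x.comp (Abelian.Ext.mk₀ (scalarEnd S T D 0)) (add_zero i) = 0
    have h : scalarEnd S T D 0 = 0 := by
      unfold scalarEnd; rw [map_zero]; rfl
    rw [h, Abelian.Ext.mk₀_zero, Abelian.Ext.comp_zero]

/-- `Ext_S^i(M, D)` and `Ext_S^i(N, D)` are isomorphic as `T`-modules. -/
def ExtIso [SMulCommClass T S D] (M N : Type u) [AddCommGroup M] [Module S M]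
    [AddCommGroup N] [Module S N] (i : ℕ) : Prop :=
  letI := extModule S T D M i
  letI := extModule S T D N i
  Nonempty (ExtGroup S D M i ≃ₗ[T] ExtGroup S D N i)

/-- The finitely generated `S`-module `M` is `n`-torsionfree: `Ext_T^i(B, D) = 0` for `1 ≤ i ≤ n`
and for every transpose `B` of `M`. (Transposes are unique up to projective summands, so this does
not depend on the transpose.) -/
def IsTorsionfree (n : ℕ) (M : Type u) [AddCommGroup M] [Module S M] : Prop :=
  Module.Finite S M ∧
    ∀ (B : Type u) [AddCommGroup B] [Module T B], IsTranspose S T D M B →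
      ∀ i : ℕ, 1 ≤ i → i ≤ n → Subsingleton (ExtGroup T D B i)

end Transpose

/-!
# Gorenstein transposes and transposes

Two facts carry the proof.

The first is about arbitrary modules: a module is Gorenstein projective as soon as it lies in a class
of modules without extensions by projectives in which every module embeds into a projective one
with cokernel in the class (`IsGorensteinProjective.of_coinduction`). This makes Gorenstein
projective modules closed under extensions and kernels of epimorphisms
(`IsGorensteinProjective.middle`, `IsGorensteinProjective.left`). Over Noetherian rings, a finitely
generated Gorenstein projective module has finitely generated cosyzygies of the same kind
(`IsGorensteinProjective.exists_finite_cosyzygy`). Hence it is reflexive, and its dual is again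
Gorenstein projective (`IsDualizingBimodule.evalBidual_bijective`,
`IsDualizingBimodule.isGorensteinProjective_dual`).

The second is the comparison of a Gorenstein transpose `M` and a transpose `N` of the same module:
there is an exact sequence `0 → M → N ⊕ Q → H → 0` with `Q` finitely generated projective and `H`
finitely generated Gorenstein projective (`IsDualizingBimodule.exists_shortExact`). It comes from
the mapping cone of a comparison map between the two presentations. Along this sequence:

* higher extension groups by `R` agree, since those of `H` vanish (`IsShortExact.extIso`);
* Gorenstein projective dimensions agree (`IsShortExact.gorensteinProjectiveDim_eq`);
* a transpose of `N` is a Gorenstein transpose of `M`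
  (`IsDualizingBimodule.isGorensteinTranspose_left`), so by the agreement of extension groups on
  the other side `M` and `N` are `n`-torsionfree simultaneously;
* `M` is Gorenstein projective if and only if `N` is.

If `A` is Gorenstein projective then `0` is a Gorenstein transpose of `A`, so all its Gorenstein
transposes are Gorenstein projective; the converse follows since `A` is a transpose of its
transposes (`IsDualizingBimodule.isTranspose_symm`).
-/

/-! ### Short exact sequences and extension groups -/

/-- The sequence `0 → A --i→ B --p→ C → 0` of `S`-modules is exact. -/
structure IsShortExact {S : Type*} [Ring S] {A B C : Type*} [AddCommGroup A] [Module S A]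
    [AddCommGroup B] [Module S B] [AddCommGroup C] [Module S C]
    (i : A →ₗ[S] B) (p : B →ₗ[S] C) : Prop where
  injective : Function.Injective i
  exact : Function.Exact i p
  surjective : Function.Surjective p

namespace IsShortExact

section Basic

variable {S : Type*} [Ring S] {A B C : Type*} [AddCommGroup A] [Module S A]
  [AddCommGroup B] [Module S B] [AddCommGroup C] [Module S C]

theorem of_ker {p : B →ₗ[S] C} (hp : Function.Surjective p) :
    IsShortExact (LinearMap.ker p).subtype p :=
  ⟨Subtype.val_injective, LinearMap.exact_subtype_ker_map p, hp⟩

theorem of_injective {i : A →ₗ[S] B} (hi : Function.Injective i) :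
    IsShortExact i (LinearMap.range i).mkQ :=
  ⟨hi, LinearMap.exact_map_mkQ_range i, Submodule.mkQ_surjective _⟩

variable (S A C) in
theorem prod : IsShortExact (LinearMap.inl S A C) (LinearMap.snd S A C) :=
  ⟨LinearMap.inl_injective, Function.Exact.inl_snd, LinearMap.snd_surjective⟩

theorem comp_eq_zero {i : A →ₗ[S] B} {p : B →ₗ[S] C} (h : IsShortExact i p) : p ∘ₗ i = 0 :=
  h.exact.linearMap_comp_eq_zero

theorem comp_equiv {A' : Type*} [AddCommGroup A'] [Module S A'] {i : A →ₗ[S] B} {p : B →ₗ[S] C}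
    (h : IsShortExact i p) (e : A' ≃ₗ[S] A) : IsShortExact (i ∘ₗ e.toLinearMap) p :=
  ⟨h.injective.comp e.injective, fun b => by
    rw [h.exact b]
    exact ⟨fun ⟨a, ha⟩ => ⟨e.symm a, by simpa using ha⟩, fun ⟨a, ha⟩ => ⟨e a, ha⟩⟩, h.surjective⟩

end Basic

section Ext

variable {S : Type u} [Ring S] {A B C : Type u} [AddCommGroup A] [Module S A]
  [AddCommGroup B] [Module S B] [AddCommGroup C] [Module S C]
  {i : A →ₗ[S] B} {p : B →ₗ[S] C} (h : IsShortExact i p)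

include h

/-- The categorical form of a short exact sequence of modules. -/
theorem shortExact : (ShortComplex.mk (ModuleCat.ofHom i) (ModuleCat.ofHom p)
    (by rw [← ModuleCat.ofHom_comp, h.comp_eq_zero]; rfl)).ShortExact :=
  ModuleCat.shortComplex_shortExact _ h.exact h.injective h.surjective

variable (Q : ModuleCat.{u} S) (n : ℕ)

theorem ext_subsingleton_middle [Subsingleton (Abelian.Ext (ModuleCat.of S A) Q n)]
    [Subsingleton (Abelian.Ext (ModuleCat.of S C) Q n)] :
    Subsingleton (Abelian.Ext (ModuleCat.of S B) Q n) :=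
  subsingleton_of_forall_eq 0 fun x => by
    obtain ⟨y, rfl⟩ := Abelian.Ext.contravariant_sequence_exact₂ h.shortExact Q x
      (Subsingleton.elim (α := Abelian.Ext (ModuleCat.of S A) Q n) _ _)
    rw [Subsingleton.elim (α := Abelian.Ext (ModuleCat.of S C) Q n) y 0, Abelian.Ext.comp_zero]

theorem ext_subsingleton_left [Subsingleton (Abelian.Ext (ModuleCat.of S B) Q n)]
    [Subsingleton (Abelian.Ext (ModuleCat.of S C) Q (n + 1))] :
    Subsingleton (Abelian.Ext (ModuleCat.of S A) Q n) :=
  subsingleton_of_forall_eq 0 fun x => by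
    obtain ⟨y, rfl⟩ := Abelian.Ext.contravariant_sequence_exact₁ h.shortExact Q x (add_comm 1 n)
      (Subsingleton.elim (α := Abelian.Ext (ModuleCat.of S C) Q (n + 1)) _ _)
    rw [Subsingleton.elim (α := Abelian.Ext (ModuleCat.of S B) Q n) y 0, Abelian.Ext.comp_zero]

theorem ext_subsingleton_right [Subsingleton (Abelian.Ext (ModuleCat.of S A) Q n)]
    [Subsingleton (Abelian.Ext (ModuleCat.of S B) Q (n + 1))] :
    Subsingleton (Abelian.Ext (ModuleCat.of S C) Q (n + 1)) :=
  subsingleton_of_forall_eq 0 fun x => by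
    obtain ⟨y, rfl⟩ := Abelian.Ext.contravariant_sequence_exact₃ h.shortExact Q x
      (Subsingleton.elim (α := Abelian.Ext (ModuleCat.of S B) Q (n + 1)) _ _) (add_comm 1 n)
    rw [Subsingleton.elim (α := Abelian.Ext (ModuleCat.of S A) Q n) y 0, Abelian.Ext.comp_zero]

/-- If `Ext¹(C, Q) = 0`, every map from `A` to `Q` extends to `B`. -/
theorem exists_extension {Q : Type u} [AddCommGroup Q] [Module S Q]
    [Subsingleton (Abelian.Ext (ModuleCat.of S C) (ModuleCat.of S Q) 1)] (φ : A →ₗ[S] Q) :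
    ∃ ψ : B →ₗ[S] Q, ψ ∘ₗ i = φ := by
  obtain ⟨y, hy⟩ := Abelian.Ext.contravariant_sequence_exact₁ h.shortExact (ModuleCat.of S Q)
    (Abelian.Ext.mk₀ (ModuleCat.ofHom φ)) (add_zero 1)
    (Subsingleton.elim (α := Abelian.Ext (ModuleCat.of S C) (ModuleCat.of S Q) 1) _ _)
  obtain ⟨f, rfl⟩ := (Abelian.Ext.mk₀_bijective _ _).2 y
  rw [Abelian.Ext.mk₀_comp_mk₀] at hy
  exact ⟨f.hom, congrArg ModuleCat.Hom.hom ((Abelian.Ext.mk₀_bijective _ _).1 hy)⟩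

/-- If `B` is projective and every map from `A` to `Q` extends to `B`, then `Ext¹(C, Q) = 0`. -/
theorem ext_one_subsingleton {Q : Type u} [AddCommGroup Q] [Module S Q] [Module.Projective S B]
    (hext : ∀ φ : A →ₗ[S] Q, ∃ ψ : B →ₗ[S] Q, ψ ∘ₗ i = φ) :
    Subsingleton (Abelian.Ext (ModuleCat.of S C) (ModuleCat.of S Q) 1) := by
  have : Projective (ModuleCat.of S B) := (IsProjective.iff_projective _).1 inferInstance
  refine subsingleton_of_forall_eq 0 fun x => ?_
  obtain ⟨y, rfl⟩ := Abelian.Ext.contravariant_sequence_exact₃ h.shortExact (ModuleCat.of S Q) x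
    (Abelian.Ext.eq_zero_of_projective _) (add_zero 1)
  obtain ⟨f, rfl⟩ := (Abelian.Ext.mk₀_bijective _ _).2 y
  obtain ⟨ψ, hψ⟩ := hext f.hom
  have hf : f = ModuleCat.ofHom i ≫ ModuleCat.ofHom ψ := by
    exact (congrArg ModuleCat.ofHom hψ).symm
  rw [hf, ← Abelian.Ext.mk₀_comp_mk₀]
  exact h.shortExact.extClass_comp_assoc _

end Ext

end IsShortExact

/-- `Ext_S^i(G, Q) = 0` for all `i ≥ 1` and all projective `S`-modules `Q`. -/
def ExtVanish (S : Type u) [Ring S] (G : Type u) [AddCommGroup G] [Module S G] : Prop :=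
  ∀ Q : ModuleCat.{u} S, Module.Projective S Q → ∀ n : ℕ,
    Subsingleton (Abelian.Ext (ModuleCat.of S G) Q (n + 1))

section ExtVanish

variable {S : Type u} [Ring S] {A B C : Type u} [AddCommGroup A] [Module S A]
  [AddCommGroup B] [Module S B] [AddCommGroup C] [Module S C]
  {i : A →ₗ[S] B} {p : B →ₗ[S] C}

theorem ext_subsingleton_of_projective [Module.Projective S A] (Q : ModuleCat.{u} S) (n : ℕ) :
    Subsingleton (Abelian.Ext (ModuleCat.of S A) Q (n + 1)) := by
  have : Projective (ModuleCat.of S A) := (IsProjective.iff_projective _).1 inferInstance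
  exact subsingleton_of_forall_eq 0 Abelian.Ext.eq_zero_of_projective

theorem ExtVanish.of_projective [Module.Projective S A] : ExtVanish S A :=
  fun Q _ n => ext_subsingleton_of_projective Q n

theorem ExtVanish.middle (h : IsShortExact i p) (hA : ExtVanish S A) (hC : ExtVanish S C) :
    ExtVanish S B := fun Q hQ n => by
  have := hA Q hQ n
  have := hC Q hQ n
  exact h.ext_subsingleton_middle Q (n + 1)

theorem ExtVanish.left (h : IsShortExact i p) (hB : ExtVanish S B) (hC : ExtVanish S C) :
    ExtVanish S A := fun Q hQ n => by
  have := hB Q hQ n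
  have := hC Q hQ (n + 1)
  exact h.ext_subsingleton_left Q (n + 1)

theorem ExtVanish.of_equiv (hA : ExtVanish S A) (e : A ≃ₗ[S] B) : ExtVanish S B := by
  refine ExtVanish.left (C := PUnit) (i := e.symm.toLinearMap) (p := 0)
    ⟨e.symm.injective, ?_, ?_⟩ hA ExtVanish.of_projective
  · intro x; simp
  · intro x; exact ⟨0, rfl⟩

theorem ExtVanish.exists_extension (hC : ExtVanish S C) (h : IsShortExact i p) {Q : Type u}
    [AddCommGroup Q] [Module S Q] [hQ : Module.Projective S Q] (φ : A →ₗ[S] Q) :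
    ∃ ψ : B →ₗ[S] Q, ψ ∘ₗ i = φ := by
  have := hC (ModuleCat.of S Q) hQ 0
  exact h.exists_extension φ

end ExtVanish

/-! ### Gorenstein projective modules -/

section Factor

variable {S : Type*} [Ring S] {A B C : Type*} [AddCommGroup A] [Module S A]
  [AddCommGroup B] [Module S B] [AddCommGroup C] [Module S C]

theorem LinearMap.exists_comp_eq_of_ker_le {p : B →ₗ[S] C} (hp : Function.Surjective p)
    (φ : B →ₗ[S] A) (h : LinearMap.ker p ≤ LinearMap.ker φ) : ∃ ψ : C →ₗ[S] A, ψ ∘ₗ p = φ := by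
  refine ⟨(LinearMap.ker p).liftQ φ h ∘ₗ (p.quotKerEquivOfSurjective hp).symm.toLinearMap, ?_⟩
  ext b
  have : (p.quotKerEquivOfSurjective hp).symm (p b) = (LinearMap.ker p).mkQ b := by
    rw [LinearEquiv.symm_apply_eq]; rfl
  simp [this]

theorem LinearMap.exists_comp_eq_of_range_le {i : A →ₗ[S] B} (hi : Function.Injective i)
    (φ : C →ₗ[S] B) (h : LinearMap.range φ ≤ LinearMap.range i) :
    ∃ ψ : C →ₗ[S] A, i ∘ₗ ψ = φ := by
  refine ⟨(LinearEquiv.ofInjective i hi).symm.toLinearMap ∘ₗ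
    φ.codRestrict (LinearMap.range i) fun c => h ⟨c, rfl⟩, ?_⟩
  ext c
  have := (LinearEquiv.ofInjective i hi).apply_symm_apply
    (φ.codRestrict (LinearMap.range i) (fun c => h ⟨c, rfl⟩) c)
  exact congrArg Subtype.val this

theorem IsShortExact.exists_desc {i : A →ₗ[S] B} {p : B →ₗ[S] C} (h : IsShortExact i p)
    {D : Type*} [AddCommGroup D] [Module S D] (φ : B →ₗ[S] D) (hφ : φ ∘ₗ i = 0) :
    ∃ ψ : C →ₗ[S] D, ψ ∘ₗ p = φ :=
  LinearMap.exists_comp_eq_of_ker_le h.surjective φ fun b hb => by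
    obtain ⟨a, rfl⟩ := (h.exact b).1 hb
    exact LinearMap.congr_fun hφ a

end Factor

/-- `C` is the quotient of a projective module by a submodule isomorphic to `G`. -/
def IsCosyzygy (S : Type u) [Ring S] (G C : ModuleCat.{u} S) : Prop :=
  ∃ (P : ModuleCat.{u} S) (i : G →ₗ[S] P) (p : P →ₗ[S] C), Module.Projective S P ∧ IsShortExact i p

namespace IsGorensteinProjective

section Characterization

variable {S : Type u} [Ring S] {G : Type u} [AddCommGroup G] [Module S G]

/-- Splicing short exact sequences `0 → Z k → P k → Z (k + 1) → 0`, `k ∈ ℤ`, with projective middle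
terms gives a complete resolution as soon as the `Z k` have no extensions by projectives. -/
theorem of_int_sequence (Z : ℤ → ModuleCat.{u} S) (hW : ∀ k, ExtVanish S (Z k))
    (hZ : ∀ k, IsCosyzygy S (Z k) (Z (k + 1))) (e : G ≃ₗ[S] Z (0 + 1)) :
    IsGorensteinProjective S G := by
  choose P i p hP h using hZ
  refine ⟨P, fun k => i (k + 1) ∘ₗ p k, hP, fun k x => ?_, fun Q hQ k φ => ⟨fun hφ => ?_, ?_⟩, ?_⟩
  · have h1 : i (k + 1 + 1) (p (k + 1) x) = 0 ↔ p (k + 1) x = 0 :=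
      map_eq_zero_iff _ (h (k + 1 + 1)).injective
    rw [LinearMap.comp_apply, h1, (h (k + 1)).exact x]
    constructor
    · rintro ⟨z, rfl⟩
      obtain ⟨y, rfl⟩ := (h k).surjective z
      exact ⟨y, rfl⟩
    · rintro ⟨y, rfl⟩
      exact ⟨p k y, rfl⟩
  · have h1 : φ ∘ₗ i (k + 1) = 0 := by
      ext z
      obtain ⟨y, rfl⟩ := (h k).surjective z
      exact LinearMap.congr_fun hφ y
    obtain ⟨ψ, hψ⟩ := (h (k + 1)).exists_desc φ h1
    obtain ⟨χ, hχ⟩ := (hW (k + 1 + 1 + 1)).exists_extension (h (k + 1 + 1)) ψ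
    exact ⟨χ, by simp only [← LinearMap.comp_assoc, hχ, hψ]⟩
  · rintro ⟨χ, rfl⟩
    ext y
    have : p (k + 1) (i (k + 1) (p k y)) = 0 := (h (k + 1)).exact.apply_apply_eq_zero _
    simp [this]
  · have h1 : LinearMap.range (i (0 + 1) ∘ₗ p 0) = LinearMap.range (i (0 + 1)) :=
      LinearMap.range_comp_of_range_eq_top _ (LinearMap.range_eq_top.2 (h 0).surjective)
    exact ⟨e.trans ((LinearEquiv.ofInjective _ (h (0 + 1)).injective).trans
      (LinearEquiv.ofEq _ _ h1.symm))⟩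

/-- Coinduction: a module is Gorenstein projective if it lies in a class of modules without
extensions by projectives in which every module has a cosyzygy. The other half of the complete
resolution is an ordinary projective resolution. -/
theorem of_coinduction (𝒞 : ModuleCat.{u} S → Prop) (hW : ∀ G, 𝒞 G → ExtVanish S G)
    (hc : ∀ G, 𝒞 G → ∃ C, 𝒞 C ∧ IsCosyzygy S G C) (hG : 𝒞 (ModuleCat.of S G)) :
    IsGorensteinProjective S G := by
  have hpred : ∀ G : {G : ModuleCat.{u} S // ExtVanish S G},
      ∃ K : {G : ModuleCat.{u} S // ExtVanish S G}, IsCosyzygy S K.1 G.1 := fun G => by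
    have h := IsShortExact.of_ker (Finsupp.linearCombination_id_surjective S G.1)
    exact ⟨⟨ModuleCat.of S (LinearMap.ker (Finsupp.linearCombination S (id : G.1 → G.1))),
      ExtVanish.left h ExtVanish.of_projective G.2⟩, ModuleCat.of S (G.1 →₀ S), _, _,
      inferInstanceAs (Module.Projective S (G.1 →₀ S)), h⟩
  have hsucc : ∀ G : {G // 𝒞 G}, ∃ C : {G // 𝒞 G}, IsCosyzygy S G.1 C.1 := fun G => by
    obtain ⟨C, hC, h⟩ := hc G.1 G.2
    exact ⟨⟨C, hC⟩, h⟩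
  choose pred hpred using hpred
  choose succ hsucc using hsucc
  let G₁ : {G // 𝒞 G} := ⟨ModuleCat.of S G, hG⟩
  let G₀ : {G : ModuleCat.{u} S // ExtVanish S G} := ⟨ModuleCat.of S G, hW _ hG⟩
  -- `G` is placed in degree `1`, since the definition compares it with the image of `P 0 → P 1`
  let Z : ℤ → ModuleCat.{u} S := fun k => match k with
    | Int.ofNat 0 => (pred G₀).1
    | Int.ofNat (n + 1) => (succ^[n] G₁).1
    | Int.negSucc n => (pred^[n + 2] G₀).1
  refine of_int_sequence Z (fun k => ?_) (fun k => ?_) (LinearEquiv.refl S G)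
  · match k with
    | Int.ofNat 0 => exact (pred G₀).2
    | Int.ofNat (n + 1) => exact hW _ (succ^[n] G₁).2
    | Int.negSucc n => exact (pred^[n + 2] G₀).2
  · match k with
    | Int.ofNat 0 => exact hpred G₀
    | Int.ofNat (n + 1) =>
      change IsCosyzygy S (succ^[n] G₁).1 (succ^[n + 1] G₁).1
      rw [Function.iterate_succ_apply']
      exact hsucc _
    | Int.negSucc 0 => exact hpred (pred G₀)
    | Int.negSucc (n + 1) =>
      change IsCosyzygy S (pred^[n + 3] G₀).1 (pred^[n + 2] G₀).1
      rw [Function.iterate_succ_apply' pred (n + 2)]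
      exact hpred _

/-- The images of the differentials of a complete resolution have no extensions by projectives:
exactness under `Hom(-, Q)` gives `Ext¹`, and dimension shifting along the resolution gives the rest. -/
theorem extVanish_range {P : ℤ → ModuleCat.{u} S} {d : ∀ i : ℤ, P i →ₗ[S] P (i + 1)}
    (hP : ∀ i, Module.Projective S (P i)) (hd : ∀ i, Function.Exact (d i) (d (i + 1)))
    (hQ : ∀ Q : ModuleCat.{u} S, Module.Projective S Q → ∀ i,
      Function.Exact (fun φ : P (i + 1 + 1) →ₗ[S] Q => φ ∘ₗ d (i + 1))
        (fun φ : P (i + 1) →ₗ[S] Q => φ ∘ₗ d i)) (k : ℤ) :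
    ExtVanish S (LinearMap.range (d k)) := by
  have hse : ∀ k, IsShortExact (LinearMap.range (d k)).subtype (d (k + 1)).rangeRestrict := fun k =>
    ⟨Subtype.val_injective, fun x => by
      rw [← Subtype.val_inj]
      simpa using hd k x, LinearMap.surjective_rangeRestrict _⟩
  intro Q hQp n
  induction n generalizing k with
  | zero =>
    obtain ⟨k, rfl⟩ : ∃ j, k = j + 1 + 1 := ⟨k - 2, by ring⟩
    have := hP (k + 1 + 1)
    refine (hse (k + 1)).ext_one_subsingleton fun φ => ?_
    obtain ⟨ψ, hψ⟩ := (hQ Q hQp k (φ ∘ₗ (d (k + 1)).rangeRestrict)).1 (by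
      ext x
      have : (d (k + 1)).rangeRestrict (d k x) = 0 :=
        Subtype.ext ((hd k).apply_apply_eq_zero x)
      simp [this])
    refine ⟨ψ, ?_⟩
    ext ⟨_, x, rfl⟩
    exact LinearMap.congr_fun hψ x
  | succ n ih =>
    obtain ⟨k, rfl⟩ : ∃ j, k = j + 1 := ⟨k - 1, by ring⟩
    have := hP (k + 1)
    have := ih k
    have := ext_subsingleton_of_projective (S := S) (A := P (k + 1)) Q (n + 1)
    exact (hse k).ext_subsingleton_right Q (n + 1)

theorem extVanish (h : IsGorensteinProjective S G) : ExtVanish S G := by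
  obtain ⟨P, d, hP, hd, hQ, ⟨e⟩⟩ := h
  exact (extVanish_range hP hd hQ 0).of_equiv e.symm

theorem exists_cosyzygy (h : IsGorensteinProjective S G) :
    ∃ (P C : ModuleCat.{u} S) (i : G →ₗ[S] P) (p : P →ₗ[S] C), Module.Projective S P ∧
      IsShortExact i p ∧ IsGorensteinProjective S C := by
  obtain ⟨P, d, hP, hd, hQ, ⟨e⟩⟩ := h
  refine ⟨P (0 + 1), ModuleCat.of S (LinearMap.range (d (0 + 1))),
    (LinearMap.range (d 0)).subtype ∘ₗ e.toLinearMap, (d (0 + 1)).rangeRestrict, hP _,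
    IsShortExact.comp_equiv ⟨Subtype.val_injective, fun x => by
      rw [← Subtype.val_inj]
      simpa using hd 0 x, LinearMap.surjective_rangeRestrict _⟩ e,
    fun k => P (k + 1), fun k => d (k + 1), fun k => hP _, fun k => hd _, fun Q hQp k => hQ Q hQp _,
    ⟨LinearEquiv.refl S _⟩⟩

/-- A module without extensions by projectives that has a Gorenstein projective cosyzygy is itself
Gorenstein projective. -/
theorem of_cosyzygy (hG : ExtVanish S G) {P C : Type u} [AddCommGroup P] [Module S P]
    [AddCommGroup C] [Module S C] [hP : Module.Projective S P] {i : G →ₗ[S] P} {p : P →ₗ[S] C}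
    (h : IsShortExact i p) (hC : IsGorensteinProjective S C) : IsGorensteinProjective S G := by
  refine of_coinduction (fun X => ExtVanish S X ∧ ∃ C : ModuleCat.{u} S,
    IsGorensteinProjective S C ∧ IsCosyzygy S X C) (fun X hX => hX.1) ?_
    ⟨hG, ModuleCat.of S C, hC, ModuleCat.of S P, i, p, hP, h⟩
  rintro X ⟨-, C, hC, h⟩
  obtain ⟨P', C', i', p', hP', h', hC'⟩ := hC.exists_cosyzygy
  exact ⟨C, ⟨hC.extVanish, C', hC', P', i', p', hP', h'⟩, h⟩

end Characterization

section Closure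

variable {S : Type u} [Ring S] {A B C : Type u} [AddCommGroup A] [Module S A]
  [AddCommGroup B] [Module S B] [AddCommGroup C] [Module S C]

theorem of_equiv (hA : IsGorensteinProjective S A) (e : A ≃ₗ[S] B) :
    IsGorensteinProjective S B := by
  obtain ⟨P, d, hP, hd, hQ, ⟨e'⟩⟩ := hA
  exact ⟨P, d, hP, hd, hQ, ⟨e.symm.trans e'⟩⟩

theorem of_projective [hA : Module.Projective S A] : IsGorensteinProjective S A := by
  refine of_coinduction (fun X => Module.Projective S X) (fun X hX => ExtVanish.of_projective)
    (fun X hX => ⟨ModuleCat.of S PUnit, inferInstanceAs (Module.Projective S PUnit.{u + 1}),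
      X, LinearMap.id, 0, hX, Function.injective_id, fun x => ?_, fun x => ⟨0, rfl⟩⟩) hA
  exact ⟨fun _ => ⟨x, rfl⟩, fun _ => rfl⟩

/-- In the horseshoe for `0 → A → B → C → 0`, the map from `A` into a projective extends to `B`
because `Ext¹(C, -)` vanishes on projectives; the cosyzygy of `B` is again an extension. -/
theorem middle {i : A →ₗ[S] B} {p : B →ₗ[S] C} (h : IsShortExact i p)
    (hA : IsGorensteinProjective S A) (hC : IsGorensteinProjective S C) :
    IsGorensteinProjective S B := by
  refine of_coinduction (fun X => ∃ (A C : ModuleCat.{u} S) (i : A →ₗ[S] X) (p : X →ₗ[S] C),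
    IsShortExact i p ∧ IsGorensteinProjective S A ∧ IsGorensteinProjective S C) ?_ ?_
    ⟨ModuleCat.of S A, ModuleCat.of S C, i, p, h, hA, hC⟩
  · rintro X ⟨A, C, i, p, h, hA, hC⟩
    exact ExtVanish.middle h hA.extVanish hC.extVanish
  · rintro X ⟨A, C, i, p, h, hA, hC⟩
    obtain ⟨P₁, A', i₁, p₁, hP₁, h₁, hA'⟩ := hA.exists_cosyzygy
    obtain ⟨P₂, C', i₂, p₂, hP₂, h₂, hC'⟩ := hC.exists_cosyzygy
    obtain ⟨ψ, hψ⟩ := hC.extVanish.exists_extension h i₁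
    have hψ' : ∀ a, ψ (i a) = i₁ a := LinearMap.congr_fun hψ
    let j : X →ₗ[S] P₁ × P₂ := ψ.prod (i₂ ∘ₗ p)
    have hj : Function.Injective j := by
      rw [injective_iff_map_eq_zero]
      intro x hx
      have hx1 : ψ x = 0 := congrArg Prod.fst hx
      have hx2 : i₂ (p x) = 0 := congrArg Prod.snd hx
      rw [map_eq_zero_iff _ h₂.injective] at hx2
      obtain ⟨a, rfl⟩ := (h.exact x).1 hx2
      rw [hψ', map_eq_zero_iff _ h₁.injective] at hx1
      rw [hx1, map_zero]
    let Q := (P₁ × P₂) ⧸ LinearMap.range j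
    let q : (P₁ × P₂) →ₗ[S] Q := (LinearMap.range j).mkQ
    have hq : ∀ y, q y = 0 ↔ ∃ x, j x = y := fun y => Submodule.Quotient.mk_eq_zero _
    obtain ⟨α, hα⟩ := h₁.exists_desc (q ∘ₗ LinearMap.inl S P₁ P₂) (by
      ext a
      refine (hq _).2 ⟨i a, Prod.ext (hψ' a) ?_⟩
      change i₂ (p (i a)) = 0
      rw [h.exact.apply_apply_eq_zero, map_zero])
    obtain ⟨β, hβ⟩ := (IsShortExact.of_injective hj).exists_desc (p₂ ∘ₗ LinearMap.snd S P₁ P₂) (by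
      ext x
      exact h₂.exact.apply_apply_eq_zero _)
    have hα' : ∀ x, α (p₁ x) = q (x, 0) := LinearMap.congr_fun hα
    have hβ' : ∀ x, β (q x) = p₂ x.2 := LinearMap.congr_fun hβ
    refine ⟨ModuleCat.of S Q, ⟨A', C', α, β, ⟨?_, ?_, ?_⟩, hA', hC'⟩, ModuleCat.of S (P₁ × P₂), j, q,
      inferInstanceAs (Module.Projective S (P₁ × P₂)), IsShortExact.of_injective hj⟩
    · rw [injective_iff_map_eq_zero]
      intro a ha
      obtain ⟨y, rfl⟩ := h₁.surjective a
      rw [hα', hq] at ha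
      obtain ⟨x, hx⟩ := ha
      have hx1 : ψ x = y := congrArg Prod.fst hx
      have hx2 : i₂ (p x) = 0 := congrArg Prod.snd hx
      rw [map_eq_zero_iff _ h₂.injective] at hx2
      obtain ⟨a, rfl⟩ := (h.exact x).1 hx2
      rw [← hx1, hψ']
      exact h₁.exact.apply_apply_eq_zero _
    · intro z
      obtain ⟨y, rfl⟩ := (LinearMap.range j).mkQ_surjective z
      change β (q y) = 0 ↔ _
      rw [hβ']
      constructor
      · intro hy
        obtain ⟨c, hc⟩ := (h₂.exact _).1 hy
        obtain ⟨x, rfl⟩ := h.surjective c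
        refine ⟨p₁ (y.1 - ψ x), ?_⟩
        change _ = q y
        rw [hα', ← sub_eq_zero, ← map_sub, hq]
        exact ⟨-x, Prod.ext (by simp [j]) (by simp [j, hc])⟩
      · rintro ⟨a, ha⟩
        obtain ⟨t, rfl⟩ := h₁.surjective a
        change _ = q y at ha
        rw [← hβ', ← ha, hα', hβ', map_zero]
    · intro c
      obtain ⟨y, rfl⟩ := h₂.surjective c
      exact ⟨q (0, y), hβ' _⟩

theorem prod (hA : IsGorensteinProjective S A) (hC : IsGorensteinProjective S C) :
    IsGorensteinProjective S (A × C) :=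
  middle (IsShortExact.prod S A C) hA hC

/-- Embed `B` into a projective `P` with Gorenstein projective cokernel: then `P / A` is an extension
of `P / B` by `C`, hence a Gorenstein projective cosyzygy of `A`. -/
theorem left {i : A →ₗ[S] B} {p : B →ₗ[S] C} (h : IsShortExact i p)
    (hB : IsGorensteinProjective S B) (hC : IsGorensteinProjective S C) :
    IsGorensteinProjective S A := by
  obtain ⟨P, B', j, q, hP, hj, hB'⟩ := hB.exists_cosyzygy
  have hji : Function.Injective (j ∘ₗ i) := hj.injective.comp h.injective
  let r : P →ₗ[S] P ⧸ LinearMap.range (j ∘ₗ i) := (LinearMap.range (j ∘ₗ i)).mkQ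
  have hr : ∀ y, r y = 0 ↔ ∃ a, j (i a) = y := fun y => Submodule.Quotient.mk_eq_zero _
  obtain ⟨α, hα⟩ := h.exists_desc (r ∘ₗ j) (by ext a; exact (hr _).2 ⟨a, rfl⟩)
  obtain ⟨β, hβ⟩ := (IsShortExact.of_injective hji).exists_desc q (by
    ext a; exact hj.exact.apply_apply_eq_zero _)
  have hα' : ∀ x, α (p x) = r (j x) := LinearMap.congr_fun hα
  have hβ' : ∀ x, β (r x) = q x := LinearMap.congr_fun hβ
  have hαβ : IsShortExact α β := by
    refine ⟨?_, ?_, ?_⟩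
    · rw [injective_iff_map_eq_zero]
      intro c hc
      obtain ⟨b, rfl⟩ := h.surjective c
      rw [hα', hr] at hc
      obtain ⟨a, ha⟩ := hc
      rw [← hj.injective ha]
      exact h.exact.apply_apply_eq_zero _
    · intro z
      obtain ⟨y, rfl⟩ := (LinearMap.range (j ∘ₗ i)).mkQ_surjective z
      change β (r y) = 0 ↔ _
      rw [hβ', hj.exact y]
      constructor
      · rintro ⟨b, rfl⟩
        exact ⟨p b, hα' b⟩
      · rintro ⟨c, hc⟩
        obtain ⟨b, rfl⟩ := h.surjective c
        change _ = r y at hc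
        rw [hα', ← sub_eq_zero, ← map_sub, hr] at hc
        obtain ⟨a, ha⟩ := hc
        exact ⟨b - i a, by rw [map_sub, ha]; abel⟩
    · intro c
      obtain ⟨y, rfl⟩ := hj.surjective c
      exact ⟨r y, hβ' _⟩
  exact of_cosyzygy (ExtVanish.left h hB.extVanish hC.extVanish) (IsShortExact.of_injective hji)
    (middle hαβ hC hB')

theorem ker {p : B →ₗ[S] C} (hp : Function.Surjective p) (hB : IsGorensteinProjective S B)
    (hC : IsGorensteinProjective S C) : IsGorensteinProjective S (LinearMap.ker p) :=
  left (IsShortExact.of_ker hp) hB hC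

end Closure

end IsGorensteinProjective

/-! ### Finitely generated Gorenstein projective modules -/

/-- A homomorphism from a finitely generated module to a projective module factors through a
finitely generated free module. -/
theorem LinearMap.exists_factor_finite_free {S : Type u} [Ring S] {X P : Type u} [AddCommGroup X]
    [Module S X] [AddCommGroup P] [Module S P] [Module.Finite S X] [Module.Projective S P]
    (f : X →ₗ[S] P) : ∃ (ι : Type u) (_ : Fintype ι) (a : X →ₗ[S] (ι → S)) (v : (ι → S) →ₗ[S] P),
      v ∘ₗ a = f := by
  classical
  obtain ⟨s, hs⟩ := Module.projective_def'.1 ‹Module.Projective S P›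
  obtain ⟨G, hG⟩ := Module.Finite.fg_top (R := S) (M := X)
  -- the coordinates, with respect to the generators of `P`, that occur on the image of `f`
  let J : Finset P := G.biUnion fun x => (s (f x)).support
  have hJ : ∀ x, (s (f x)).support ⊆ J := fun x => by
    have h1 : (⊤ : Submodule S X) ≤ (Finsupp.supported S S (J : Set P)).comap (s ∘ₗ f) := by
      rw [← hG, Submodule.span_le]
      intro y hy
      change _ ∈ Finsupp.supported S S (J : Set P)
      rw [Finsupp.mem_supported]
      exact_mod_cast Finset.subset_biUnion_of_mem (fun x => (s (f x)).support) hy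
    have h2 := h1 (Submodule.mem_top (x := x))
    rw [Submodule.mem_comap, Finsupp.mem_supported] at h2
    exact_mod_cast h2
  refine ⟨{x // x ∈ J}, inferInstance,
    LinearMap.pi fun j => (Finsupp.lapply j.1 : (P →₀ S) →ₗ[S] S) ∘ₗ s ∘ₗ f,
    ∑ j, LinearMap.toSpanSingleton S P j.1 ∘ₗ LinearMap.proj j, ?_⟩
  ext x
  have h3 : Finsupp.linearCombination S (_root_.id : P → P) (s (f x)) = f x :=
    LinearMap.congr_fun hs (f x)
  rw [Finsupp.linearCombination_apply, Finsupp.sum_of_support_subset _ (hJ x) _ (by simp)] at h3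
  rw [← h3]
  simpa using Finset.sum_coe_sort J fun j => s (f x) j • j

theorem Module.Finite.exists_finite_free_surjective (S : Type u) [Ring S] (X : Type u)
    [AddCommGroup X] [Module S X] [Module.Finite S X] :
    ∃ (ι : Type u) (_ : Fintype ι) (f : (ι → S) →ₗ[S] X), Function.Surjective f := by
  obtain ⟨n, f, hf⟩ := Module.Finite.exists_fin' S X
  let E : (ULift.{u} (Fin n) → S) ≃ₗ[S] (Fin n → S) := LinearEquiv.funCongrLeft S S Equiv.ulift.symm
  exact ⟨ULift.{u} (Fin n), inferInstance, f ∘ₗ E.toLinearMap, hf.comp E.surjective⟩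

/-- Finitely generated Gorenstein projective modules have finitely generated Gorenstein projective
cosyzygies. An embedding `i` of `X` into a projective `P` with Gorenstein projective cokernel `C`
factors as `X → F → P` with `F` finitely generated free, and the exact sequence
`0 → F → P × F / X → C → 0` shows that `F / X` is Gorenstein projective. -/
theorem IsGorensteinProjective.exists_finite_cosyzygy {S : Type u} [Ring S] {X : Type u}
    [AddCommGroup X] [Module S X] [Module.Finite S X] (hX : IsGorensteinProjective S X) :
    ∃ (P C : ModuleCat.{u} S) (i : X →ₗ[S] P) (p : P →ₗ[S] C), Module.Finite S P ∧
      Module.Projective S P ∧ Module.Finite S C ∧ IsGorensteinProjective S C ∧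
      IsShortExact i p := by
  obtain ⟨P, C, i, p, hP, h, hC⟩ := hX.exists_cosyzygy
  obtain ⟨ι, _, a, v, hva⟩ := i.exists_factor_finite_free
  have hva' : ∀ x, v (a x) = i x := LinearMap.congr_fun hva
  have ha : Function.Injective a := fun x y hxy => h.injective (by rw [← hva', hxy, hva'])
  let q := (LinearMap.range a).mkQ
  have hq : ∀ y, q y = 0 ↔ ∃ x, a x = y := fun y => Submodule.Quotient.mk_eq_zero _
  obtain ⟨w, hw⟩ := (IsShortExact.of_injective ha).exists_desc (p ∘ₗ v) (by
    ext x
    change p (v (a x)) = 0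
    rw [hva', h.exact.apply_apply_eq_zero])
  have hw' : ∀ y, w (q y) = p (v y) := LinearMap.congr_fun hw
  have hse : IsShortExact (v.prod q) (p ∘ₗ LinearMap.fst S P _ - w ∘ₗ LinearMap.snd S P _) := by
    refine ⟨?_, ?_, ?_⟩
    · rw [injective_iff_map_eq_zero]
      intro y hy
      have hy1 : v y = 0 := congrArg Prod.fst hy
      have hy2 : q y = 0 := congrArg Prod.snd hy
      obtain ⟨x, rfl⟩ := (hq y).1 hy2
      rw [hva', map_eq_zero_iff _ h.injective] at hy1
      rw [hy1, map_zero]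
    · rintro ⟨y, z⟩
      obtain ⟨b, rfl⟩ := (LinearMap.range a).mkQ_surjective z
      change p y - w (q b) = 0 ↔ _
      rw [hw', ← map_sub, h.exact]
      constructor
      · rintro ⟨x, hx⟩
        refine ⟨b + a x, Prod.ext ?_ ?_⟩
        · change v (b + a x) = y
          rw [map_add, hva', hx]; abel
        · change q (b + a x) = q b
          rw [map_add, (hq (a x)).2 ⟨x, rfl⟩, add_zero]
      · rintro ⟨c, hc⟩
        have hc1 : v c = y := congrArg Prod.fst hc
        have hc2 : q c = q b := congrArg Prod.snd hc
        rw [← sub_eq_zero, ← map_sub, hq] at hc2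
        obtain ⟨x, hx⟩ := hc2
        exact ⟨x, by rw [← hva', hx, map_sub, hc1]⟩
    · intro c
      obtain ⟨y, rfl⟩ := h.surjective c
      exact ⟨(y, 0), by simp⟩
  have hPX := IsGorensteinProjective.middle hse .of_projective hC
  refine ⟨ModuleCat.of S (ι → S), ModuleCat.of S ((ι → S) ⧸ LinearMap.range a), a, q,
    inferInstanceAs (Module.Finite S (ι → S)), inferInstanceAs (Module.Projective S (ι → S)),
    inferInstanceAs (Module.Finite S ((ι → S) ⧸ LinearMap.range a)), ?_,
    IsShortExact.of_injective ha⟩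
  exact .left (i := LinearMap.inr S P _) (p := LinearMap.fst S P _)
    ⟨LinearMap.inr_injective, Function.Exact.inr_fst, LinearMap.fst_surjective⟩ hPX .of_projective

/-- `D` induces a duality between finitely generated projective modules over the Noetherian rings
`S` and `T`: it is free of rank one on both sides, and its endomorphisms over either ring are given
by the action of the other one. -/
structure IsDualizingBimodule (S T D : Type u) [Ring S] [Ring T] [AddCommGroup D] [Module S D]
    [Module T D] : Prop where
  noetherian_left : IsNoetherianRing S
  noetherian_right : IsNoetherianRing T
  equiv_left : Nonempty (D ≃ₗ[S] S)
  equiv_right : Nonempty (D ≃ₗ[T] T)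
  exists_smul_left : ∀ f : D →ₗ[T] D, ∃ s : S, ∀ d, f d = s • d
  exists_smul_right : ∀ f : D →ₗ[S] D, ∃ t : T, ∀ d, f d = t • d

theorem IsDualizingBimodule.symm {S T D : Type u} [Ring S] [Ring T] [AddCommGroup D] [Module S D]
    [Module T D] (hD : IsDualizingBimodule S T D) : IsDualizingBimodule T S D :=
  ⟨hD.2, hD.1, hD.4, hD.3, hD.6, hD.5⟩

theorem isDualizingBimodule_self (R : Type u) [Ring R] [IsNoetherianRing R]
    [IsNoetherianRing Rᵐᵒᵖ] : IsDualizingBimodule R Rᵐᵒᵖ R where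
  noetherian_left := inferInstance
  noetherian_right := inferInstance
  equiv_left := ⟨LinearEquiv.refl R R⟩
  equiv_right := ⟨{ MulOpposite.opAddEquiv with map_smul' := fun _ _ => rfl }⟩
  exists_smul_left f := ⟨f 1, fun d => by
    have := f.map_smul (MulOpposite.op d) 1
    simpa using this⟩
  exists_smul_right f := ⟨MulOpposite.op (f 1), fun d => by
    have := f.map_smul d 1
    simpa using this⟩

section Duality

variable (S T D : Type u) [Ring S] [Ring T] [AddCommGroup D] [Module S D] [Module T D]
  [SMulCommClass S T D] [SMulCommClass T S D]

/-- The evaluation map from an `S`-module to its double dual. -/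
def evalBidual (X : Type u) [AddCommGroup X] [Module S X] :
    X →ₗ[S] ((X →ₗ[S] D) →ₗ[T] D) where
  toFun x :=
    { toFun := fun φ => φ x
      map_add' := fun _ _ => rfl
      map_smul' := fun _ _ => rfl }
  map_add' x y := by ext φ; exact map_add φ x y
  map_smul' s x := by ext φ; exact map_smul φ s x

@[simp]
theorem evalBidual_apply {X : Type u} [AddCommGroup X] [Module S X] (x : X) (φ : X →ₗ[S] D) :
    evalBidual S T D X x φ = φ x := rfl

end Duality

/-! ### Duality -/

section Duality

variable {S T D : Type u} [Ring S] [Ring T] [AddCommGroup D] [Module S D] [Module T D]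
variable {A B C : Type u} [AddCommGroup A] [Module S A]
  [AddCommGroup B] [Module S B] [AddCommGroup C] [Module S C]
  {i : A →ₗ[S] B} {p : B →ₗ[S] C}

theorem lcomp_injective_of_surjective [SMulCommClass S T D] (hp : Function.Surjective p) :
    Function.Injective (LinearMap.lcomp T D p) := fun φ ψ h => by
  ext c
  obtain ⟨b, rfl⟩ := hp c
  exact LinearMap.congr_fun h b

namespace IsDualizingBimodule

theorem projective (hD : IsDualizingBimodule S T D) : Module.Projective S D := by
  obtain ⟨e⟩ := hD.equiv_left
  exact Module.Projective.of_equiv e.symm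

theorem exists_retract (hD : IsDualizingBimodule S T D) (P : Type u) [AddCommGroup P] [Module S P]
    [Module.Finite S P] [Module.Projective S P] : ∃ (ι : Type u) (_ : Fintype ι)
      (a : P →ₗ[S] (ι → D)) (v : (ι → D) →ₗ[S] P), v ∘ₗ a = LinearMap.id := by
  obtain ⟨e⟩ := hD.equiv_left
  obtain ⟨ι, _, a, v, h⟩ := (LinearMap.id : P →ₗ[S] P).exists_factor_finite_free
  let E : (ι → D) ≃ₗ[S] (ι → S) := LinearEquiv.piCongrRight fun _ => e
  refine ⟨ι, inferInstance, E.symm.toLinearMap ∘ₗ a, v ∘ₗ E.toLinearMap, ?_⟩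
  ext x
  simpa using LinearMap.congr_fun h x

variable [SMulCommClass S T D]

theorem dual_shortExact (hD : IsDualizingBimodule S T D) (h : IsShortExact i p)
    (hC : ExtVanish S C) : IsShortExact (LinearMap.lcomp T D p) (LinearMap.lcomp T D i) := by
  have := hD.projective
  refine ⟨lcomp_injective_of_surjective h.surjective, fun φ => ⟨fun hφ => ?_, ?_⟩,
    fun φ => hC.exists_extension h φ⟩
  · exact h.exists_desc φ hφ
  · rintro ⟨ψ, rfl⟩
    ext a
    simp [h.exact.apply_apply_eq_zero]

theorem nonempty_end_equiv (hD : IsDualizingBimodule S T D) :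
    Nonempty ((D →ₗ[S] D) ≃ₗ[T] T) := by
  obtain ⟨e⟩ := hD.equiv_right
  refine ⟨(LinearEquiv.ofBijective (LinearMap.toSpanSingleton T (D →ₗ[S] D) LinearMap.id)
    ⟨fun t t' h => ?_, fun f => ?_⟩).symm⟩
  · have h1 : t • e.symm 1 = t' • e.symm 1 := LinearMap.congr_fun h (e.symm 1)
    simpa using congrArg e h1
  · obtain ⟨t, ht⟩ := hD.exists_smul_right f
    exact ⟨t, by ext d; simp [ht]⟩

theorem dual_projective (hD : IsDualizingBimodule S T D) (P : Type u) [AddCommGroup P]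
    [Module S P] [Module.Finite S P] [Module.Projective S P] :
    Module.Projective T (P →ₗ[S] D) ∧ Module.Finite T (P →ₗ[S] D) := by
  classical
  obtain ⟨ι, _, a, v, h⟩ := hD.exists_retract P
  obtain ⟨e⟩ := hD.nonempty_end_equiv
  let E : ((ι → D) →ₗ[S] D) ≃ₗ[T] (ι → T) :=
    (LinearMap.lsum S (fun _ : ι => D) T).symm.trans (LinearEquiv.piCongrRight fun _ => e)
  have h1 : Module.Projective T ((ι → D) →ₗ[S] D) := Module.Projective.of_equiv E.symm
  have h2 : Module.Finite T ((ι → D) →ₗ[S] D) := Module.Finite.equiv E.symm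
  have h3 : LinearMap.lcomp T D a ∘ₗ LinearMap.lcomp T D v = LinearMap.id := by
    ext φ x
    exact congrArg φ (LinearMap.congr_fun h x)
  exact ⟨Module.Projective.of_split _ _ h3,
    Module.Finite.of_surjective (LinearMap.lcomp T D a) fun φ => ⟨_, LinearMap.congr_fun h3 φ⟩⟩

theorem dual_finite (hD : IsDualizingBimodule S T D) (X : Type u) [AddCommGroup X] [Module S X]
    [Module.Finite S X] : Module.Finite T (X →ₗ[S] D) := by
  have := hD.noetherian_right
  obtain ⟨ι, _, f, hf⟩ := Module.Finite.exists_finite_free_surjective S X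
  have := (hD.dual_projective (ι → S)).2
  exact Module.Finite.of_injective _ (lcomp_injective_of_surjective (T := T) (D := D) hf)

variable [SMulCommClass T S D]

theorem evalBidual_bijective_of_projective (hD : IsDualizingBimodule S T D) (P : Type u)
    [AddCommGroup P] [Module S P] [Module.Finite S P] [Module.Projective S P] :
    Function.Bijective (evalBidual S T D P) := by
  classical
  obtain ⟨ι, _, a, v, h⟩ := hD.exists_retract P
  have h' : ∀ x, v (a x) = x := LinearMap.congr_fun h
  constructor
  · intro x y hxy
    rw [← h' x, ← h' y]
    congr 1
    funext j
    exact LinearMap.congr_fun hxy (LinearMap.proj j ∘ₗ a)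
  · intro ξ
    -- endomorphisms of `D` are scalars from `T`, and `ξ` is `T`-linear
    have hξ : ∀ (f : D →ₗ[S] D) j,
        ξ (f ∘ₗ LinearMap.proj j ∘ₗ a) = f (ξ (LinearMap.proj j ∘ₗ a)) := fun f j => by
      obtain ⟨t, ht⟩ := hD.exists_smul_right f
      rw [ht, ← map_smul]
      congr 1
      ext x
      simp [ht]
    refine ⟨v (fun j => ξ (LinearMap.proj j ∘ₗ a)), ?_⟩
    ext φ
    have h1 : φ = ∑ j, (φ ∘ₗ v ∘ₗ LinearMap.single S (fun _ => D) j) ∘ₗ LinearMap.proj j ∘ₗ a := by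
      ext x
      conv_lhs => rw [← h' x, ← Finset.univ_sum_single (a x)]
      simp [map_sum]
    conv_rhs => rw [h1, map_sum]
    simp only [hξ]
    conv_lhs => rw [← Finset.univ_sum_single fun j => ξ (LinearMap.proj j ∘ₗ a)]
    simp [map_sum]

theorem evalBidual_injective (hD : IsDualizingBimodule S T D) {X : Type u} [AddCommGroup X]
    [Module S X] [Module.Finite S X] (hX : IsGorensteinProjective S X) :
    Function.Injective (evalBidual S T D X) := by
  obtain ⟨P, X', i, p, hPf, hPp, hXf, hX', h⟩ := hX.exists_finite_cosyzygy
  intro x y hxy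
  refine h.injective ((hD.evalBidual_bijective_of_projective P).1 ?_)
  ext φ
  exact LinearMap.congr_fun hxy (φ ∘ₗ i)

/-- Finitely generated Gorenstein projective modules are reflexive: `X` is a submodule of a finitely
generated projective module, which is reflexive, with a quotient that embeds into its double
dual. -/
theorem evalBidual_bijective (hD : IsDualizingBimodule S T D) {X : Type u} [AddCommGroup X]
    [Module S X] [Module.Finite S X] (hX : IsGorensteinProjective S X) :
    Function.Bijective (evalBidual S T D X) := by
  refine ⟨hD.evalBidual_injective hX, fun ξ => ?_⟩
  obtain ⟨P, X', i, p, hPf, hPp, hXf, hX', h⟩ := hX.exists_finite_cosyzygy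
  have hdual := hD.dual_shortExact h hX'.extVanish
  obtain ⟨y, hy⟩ := (hD.evalBidual_bijective_of_projective P).2 (ξ ∘ₗ LinearMap.lcomp T D i)
  have hy' : ∀ φ : P →ₗ[S] D, φ y = ξ (φ ∘ₗ i) := LinearMap.congr_fun hy
  have hpy : p y = 0 := by
    refine hD.evalBidual_injective hX' ?_
    ext φ
    have := hy' (φ ∘ₗ p)
    rw [LinearMap.comp_assoc, h.comp_eq_zero, LinearMap.comp_zero, map_zero] at this
    simpa using this
  obtain ⟨x, rfl⟩ := (h.exact y).1 hpy
  refine ⟨x, ?_⟩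
  ext φ
  obtain ⟨ψ, rfl⟩ := hdual.surjective φ
  exact hy' ψ

/-- Writing a finitely generated Gorenstein projective `X` as a submodule of `P` with quotient `X'`
presents `X*` as the quotient of `P*` by `X'*`, so `Ext¹(X*, Q) = 0` means that maps from `X'*`
to `Q` extend to `P*`. As `X'*` is finitely generated it suffices to extend maps to `D`, which
are evaluations at elements of `X'`. -/
theorem extVanish_dual (hD : IsDualizingBimodule S T D) {X : Type u} [AddCommGroup X]
    [Module S X] [Module.Finite S X] (hX : IsGorensteinProjective S X) :
    ExtVanish T (X →ₗ[S] D) := by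
  intro Q hQ n
  induction n generalizing X with
  | zero =>
    obtain ⟨P, X', i, p, hPf, hPp, hXf, hX', h⟩ := hX.exists_finite_cosyzygy
    have := (hD.dual_projective P).1
    have := hD.dual_finite X'
    refine (hD.dual_shortExact h hX'.extVanish).ext_one_subsingleton fun ψ => ?_
    obtain ⟨e⟩ := hD.equiv_right
    obtain ⟨ι, _, a, v, rfl⟩ := ψ.exists_factor_finite_free
    have hx : ∀ j, ∃ x : X', evalBidual S T D X' x = e.symm.toLinearMap ∘ₗ LinearMap.proj j ∘ₗ a :=
      fun j => (hD.evalBidual_bijective hX').2 _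
    choose x hx using hx
    have hy : ∀ j, ∃ y, p y = x j := fun j => h.surjective _
    choose y hy using hy
    refine ⟨v ∘ₗ LinearMap.pi fun j => e.toLinearMap ∘ₗ evalBidual S T D P (y j), ?_⟩
    rw [LinearMap.comp_assoc]
    congr 1
    ext φ j
    have h1 : φ (x j) = e.symm (a φ j) := LinearMap.congr_fun (hx j) φ
    simp [hy, h1]
  | succ n ih =>
    obtain ⟨P, X', i, p, hPf, hPp, hXf, hX', h⟩ := hX.exists_finite_cosyzygy
    have := (hD.dual_projective P).1
    have := ih hX'
    have := ext_subsingleton_of_projective (S := T) (A := P →ₗ[S] D) Q (n + 1)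
    exact (hD.dual_shortExact h hX'.extVanish).ext_subsingleton_right Q (n + 1)

/-- The dual of a finitely generated Gorenstein projective module is Gorenstein projective: dualizing
a syzygy of `X` gives a cosyzygy of `X*`. -/
theorem isGorensteinProjective_dual (hD : IsDualizingBimodule S T D) {X : Type u} [AddCommGroup X]
    [Module S X] [Module.Finite S X] (hX : IsGorensteinProjective S X) :
    IsGorensteinProjective T (X →ₗ[S] D) := by
  have := hD.noetherian_left
  refine .of_coinduction (fun M => ∃ X : ModuleCat.{u} S, Module.Finite S X ∧
    IsGorensteinProjective S X ∧ Nonempty (M ≃ₗ[T] (X →ₗ[S] D))) ?_ ?_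
    ⟨ModuleCat.of S X, inferInstanceAs (Module.Finite S X), hX, ⟨LinearEquiv.refl _ _⟩⟩
  · rintro M ⟨X, hXf, hX, ⟨e⟩⟩
    exact (hD.extVanish_dual hX).of_equiv e.symm
  · rintro M ⟨X, hXf, hX, ⟨e⟩⟩
    obtain ⟨ι, _, f, hf⟩ := Module.Finite.exists_finite_free_surjective S X
    exact ⟨ModuleCat.of T (LinearMap.ker f →ₗ[S] D), ⟨ModuleCat.of S (LinearMap.ker f),
      inferInstanceAs (Module.Finite S (LinearMap.ker f)), .ker hf .of_projective hX,
      ⟨LinearEquiv.refl _ _⟩⟩, ModuleCat.of T ((ι → S) →ₗ[S] D), _, _,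
      (hD.dual_projective (ι → S)).1,
      (hD.dual_shortExact (IsShortExact.of_ker hf) hX.extVanish).comp_equiv e⟩

end IsDualizingBimodule

end Duality

/-! ### Passing along a short exact sequence with Gorenstein projective quotient -/

section ExtIso

variable {S T D : Type u} [Ring S] [Ring T] [AddCommGroup D] [Module S D] [Module T D]
  [SMulCommClass T S D]
variable {A B C : Type u} [AddCommGroup A] [Module S A]
  [AddCommGroup B] [Module S B] [AddCommGroup C] [Module S C] {n : ℕ}

theorem ExtIso.symm (h : ExtIso S T D A B n) : ExtIso S T D B A n := by
  let _ := extModule S T D A n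
  let _ := extModule S T D B n
  obtain ⟨e⟩ := h
  exact ⟨e.symm⟩

theorem ExtIso.trans (h : ExtIso S T D A B n) (h' : ExtIso S T D B C n) : ExtIso S T D A C n := by
  let _ := extModule S T D A n
  let _ := extModule S T D B n
  let _ := extModule S T D C n
  obtain ⟨e⟩ := h
  obtain ⟨e'⟩ := h'
  exact ⟨e.trans e'⟩

theorem ExtIso.subsingleton_iff (h : ExtIso S T D A B n) :
    Subsingleton (ExtGroup S D A n) ↔ Subsingleton (ExtGroup S D B n) := by
  let _ := extModule S T D A n
  let _ := extModule S T D B n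
  obtain ⟨e⟩ := h
  exact e.toEquiv.subsingleton_congr

/-- Restriction along the inclusion of a submodule is an isomorphism on higher extension groups by
`D` if the quotient has no extensions by projectives. -/
theorem IsShortExact.extIso {i : A →ₗ[S] B} {p : B →ₗ[S] C} (h : IsShortExact i p)
    [hD : Module.Projective S D] (hC : ExtVanish S C) (hn : 1 ≤ n) : ExtIso S T D B A n := by
  obtain ⟨n, rfl⟩ := Nat.exists_eq_succ_of_ne_zero (Nat.one_le_iff_ne_zero.1 hn)
  let _ := extModule S T D A (n + 1)
  let _ := extModule S T D B (n + 1)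
  let f : ExtGroup S D B (n + 1) →ₗ[T] ExtGroup S D A (n + 1) :=
    { toFun := fun x => (Abelian.Ext.mk₀ (ModuleCat.ofHom i)).comp x (zero_add _)
      map_add' := fun x y => Abelian.Ext.comp_add _ _ _ _
      map_smul' := fun t x => (Abelian.Ext.comp_assoc_of_third_deg_zero _ _ _ _).symm }
  have hC' : ∀ k, Subsingleton (ExtGroup S D C (k + 1)) := hC (ModuleCat.of S D) hD
  refine ⟨LinearEquiv.ofBijective f ⟨?_, fun y => ?_⟩⟩
  · rw [injective_iff_map_eq_zero]
    intro x hx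
    obtain ⟨y, rfl⟩ := Abelian.Ext.contravariant_sequence_exact₂ h.shortExact _ x hx
    rw [Subsingleton.elim (α := ExtGroup S D C (n + 1)) y 0, Abelian.Ext.comp_zero]
  · exact Abelian.Ext.contravariant_sequence_exact₁ h.shortExact _ y (add_comm 1 (n + 1))
      (Subsingleton.elim (α := ExtGroup S D C (n + 1 + 1)) _ _)

end ExtIso

section Dimension

variable {S : Type u} [Ring S] {A B C M : Type u} [AddCommGroup A] [Module S A]
  [AddCommGroup B] [Module S B] [AddCommGroup C] [Module S C] [AddCommGroup M] [Module S M]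

theorem hasGorensteinProjectiveResolution_zero_iff :
    HasGorensteinProjectiveResolution S M 0 ↔ IsGorensteinProjective S M := by
  constructor
  · rintro ⟨G, d, ε, hG, h0, hε, hd, -⟩
    have := h0 1 one_pos
    refine (hG 0).of_equiv (LinearEquiv.ofBijective ε ⟨?_, hε⟩)
    rw [injective_iff_map_eq_zero]
    intro x hx
    obtain ⟨y, rfl⟩ := (hd x).1 hx
    rw [Subsingleton.elim (α := G (0 + 1)) y 0, map_zero]
  · intro hM
    let G : ℕ → ModuleCat.{u} S := fun k => match k with
      | 0 => ModuleCat.of S M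
      | _ + 1 => ModuleCat.of S PUnit
    have hs : ∀ k, Subsingleton (G (k + 1)) := fun k => inferInstanceAs (Subsingleton PUnit)
    refine ⟨G, fun _ => 0, LinearMap.id, fun k => ?_, fun k hk => ?_, Function.surjective_id,
      fun x => ?_, fun k x => ?_⟩
    · match k with
      | 0 => exact hM
      | k + 1 => exact IsGorensteinProjective.of_projective (A := PUnit.{u + 1})
    · obtain ⟨k, rfl⟩ := Nat.exists_eq_succ_of_ne_zero hk.ne'
      exact hs k
    · exact ⟨fun hx => ⟨0, hx.symm⟩, fun ⟨_, hy⟩ => hy.symm⟩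
    · exact ⟨fun _ => ⟨0, Subsingleton.elim (α := G (k + 1)) _ _⟩, fun _ => rfl⟩

theorem hasGorensteinProjectiveResolution_succ_iff {n : ℕ} :
    HasGorensteinProjectiveResolution S M (n + 1) ↔
      ∃ (K G : ModuleCat.{u} S) (i : K →ₗ[S] G) (p : G →ₗ[S] M), IsShortExact i p ∧
        IsGorensteinProjective S G ∧ HasGorensteinProjectiveResolution S K n := by
  constructor
  · rintro ⟨G, d, ε, hG, h0, hε, hd, hd'⟩
    refine ⟨ModuleCat.of S (LinearMap.ker ε), G 0, _, ε, .of_ker hε, hG 0, fun k => G (k + 1),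
      fun k => d (k + 1), (d 0).codRestrict _ fun x => hd.apply_apply_eq_zero x, fun k => hG _,
      fun k hk => h0 _ (by omega), ?_, ?_, fun k => hd' _⟩
    · rintro ⟨x, hx⟩
      obtain ⟨y, rfl⟩ := (hd x).1 hx
      exact ⟨y, rfl⟩
    · intro x
      rw [← hd' 0 x, ← Subtype.val_inj]
      rfl
  · rintro ⟨K, G₀, i, p, h, hG₀, G, d, ε, hG, h0, hε, hd, hd'⟩
    let G' : ℕ → ModuleCat.{u} S := fun k => match k with
      | 0 => G₀
      | k + 1 => G k
    let d' : ∀ k, G' (k + 1) →ₗ[S] G' k := fun k => match k with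
      | 0 => i ∘ₗ ε
      | k + 1 => d k
    refine ⟨G', d', p, fun k => ?_, fun k hk => ?_, h.surjective, fun x => ?_, fun k => ?_⟩
    · match k with
      | 0 => exact hG₀
      | k + 1 => exact hG k
    · match k with
      | 0 => omega
      | k + 1 => exact h0 k (by omega)
    · rw [h.exact x]
      constructor
      · rintro ⟨y, rfl⟩
        obtain ⟨z, rfl⟩ := hε y
        exact ⟨z, rfl⟩
      · rintro ⟨z, rfl⟩
        exact ⟨ε z, rfl⟩
    · match k with
      | 0 =>
        intro x
        rw [← hd x]
        exact map_eq_zero_iff i h.injective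
      | k + 1 => exact hd' k

/-- If `B` is covered by a Gorenstein projective `G`, then `A = ker (B → C)` is covered by the
kernel of `G → B → C`, with the same syzygy. -/
theorem HasGorensteinProjectiveResolution.left {n : ℕ} {i : A →ₗ[S] B} {p : B →ₗ[S] C}
    (h : IsShortExact i p) (hB : HasGorensteinProjectiveResolution S B n)
    (hC : IsGorensteinProjective S C) : HasGorensteinProjectiveResolution S A n := by
  cases n with
  | zero =>
    rw [hasGorensteinProjectiveResolution_zero_iff] at *
    exact .left h hB hC
  | succ n =>
    rw [hasGorensteinProjectiveResolution_succ_iff] at *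
    obtain ⟨K, G, j, q, hjq, hG, hK⟩ := hB
    have hpq : Function.Surjective (p ∘ₗ q) := h.surjective.comp hjq.surjective
    obtain ⟨ψ, hψ⟩ := LinearMap.exists_comp_eq_of_range_le h.injective
      (q ∘ₗ (LinearMap.ker (p ∘ₗ q)).subtype) (by
        rintro _ ⟨x, rfl⟩
        exact (h.exact _).1 x.2)
    have hψ' : ∀ x, i (ψ x) = q x.1 := LinearMap.congr_fun hψ
    refine ⟨K, ModuleCat.of S (LinearMap.ker (p ∘ₗ q)), j.codRestrict _ fun x => ?_, ψ,
      ⟨fun x y hxy => hjq.injective (congrArg Subtype.val hxy), fun x => ?_, fun a => ?_⟩,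
      .ker hpq hG hC, hK⟩
    · simp [hjq.exact.apply_apply_eq_zero]
    · rw [← map_eq_zero_iff i h.injective, hψ', hjq.exact]
      exact ⟨fun ⟨y, hy⟩ => ⟨y, Subtype.ext hy⟩, fun ⟨y, hy⟩ => ⟨y, congrArg Subtype.val hy⟩⟩
    · obtain ⟨x, hx⟩ := hjq.surjective (i a)
      refine ⟨⟨x, ?_⟩, h.injective ?_⟩
      · simp [hx, h.exact.apply_apply_eq_zero]
      · exact (hψ' _).trans hx

/-- The horseshoe over `0 → A → B → C → 0`, for a Gorenstein projective cover of `A` and a free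
cover of `C`. -/
theorem HasGorensteinProjectiveResolution.middle {n : ℕ} {i : A →ₗ[S] B} {p : B →ₗ[S] C}
    (h : IsShortExact i p) (hA : HasGorensteinProjectiveResolution S A n)
    (hC : IsGorensteinProjective S C) : HasGorensteinProjectiveResolution S B n := by
  induction n generalizing A B C with
  | zero =>
    rw [hasGorensteinProjectiveResolution_zero_iff] at *
    exact .middle h hA hC
  | succ n ih =>
    rw [hasGorensteinProjectiveResolution_succ_iff] at *
    obtain ⟨K, G, j, q, hjq, hG, hK⟩ := hA
    let π : (C →₀ S) →ₗ[S] C := Finsupp.linearCombination S id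
    have hπ : Function.Surjective π := Finsupp.linearCombination_id_surjective S C
    obtain ⟨l, hl⟩ := Module.projective_lifting_property p π h.surjective
    have hl' : ∀ x, p (l x) = π x := LinearMap.congr_fun hl
    let r : (G × (C →₀ S)) →ₗ[S] B := (i ∘ₗ q).coprod l
    have hr : ∀ x, r x = i (q x.1) + l x.2 := fun x => LinearMap.coprod_apply _ _ x
    have hpr : ∀ x, p (r x) = π x.2 := fun x => by
      rw [hr, map_add, h.exact.apply_apply_eq_zero, zero_add, hl']
    have hrs : Function.Surjective r := fun b => by
      obtain ⟨c, hc⟩ := hπ (p b)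
      obtain ⟨a, ha⟩ := (h.exact (b - l c)).1 (by rw [map_sub, hl', hc, sub_self])
      obtain ⟨g, rfl⟩ := hjq.surjective a
      exact ⟨(g, c), by rw [hr, ha, sub_add_cancel]⟩
    refine ⟨ModuleCat.of S (LinearMap.ker r), ModuleCat.of S (G × (C →₀ S)), _, r, .of_ker hrs,
      hG.prod .of_projective, ?_⟩
    refine ih (A := K) (C := LinearMap.ker π)
      (i := (LinearMap.inl S G (C →₀ S) ∘ₗ j).codRestrict _ fun x => ?_)
      (p := (LinearMap.snd S G (C →₀ S) ∘ₗ (LinearMap.ker r).subtype).codRestrict _ fun x => ?_)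
      ⟨fun x y hxy => ?_, ?_, ?_⟩ hK (.ker hπ .of_projective hC)
    · simp [hr, hjq.exact.apply_apply_eq_zero]
    · have : r x = 0 := x.2
      simp [← hpr, this]
    · exact hjq.injective (congrArg Prod.fst (congrArg Subtype.val hxy))
    · rintro ⟨⟨g, c⟩, hx⟩
      have hx' : i (q g) + l c = 0 := by rw [← hr (g, c)]; exact hx
      constructor
      · intro hc
        obtain rfl : c = 0 := congrArg Subtype.val hc
        rw [map_zero, add_zero, map_eq_zero_iff _ h.injective, hjq.exact] at hx'
        obtain ⟨y, rfl⟩ := hx'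
        exact ⟨y, rfl⟩
      · rintro ⟨y, hy⟩
        exact Subtype.ext (congrArg Prod.snd (congrArg Subtype.val hy)).symm
    · rintro ⟨c, hc⟩
      obtain ⟨a, ha⟩ := (h.exact (-l c)).1 (by rw [map_neg, hl', hc, neg_zero])
      obtain ⟨g, rfl⟩ := hjq.surjective a
      exact ⟨⟨(g, c), by rw [LinearMap.mem_ker, hr, ha, neg_add_cancel]⟩, rfl⟩

theorem IsShortExact.gorensteinProjectiveDim_eq {i : A →ₗ[S] B} {p : B →ₗ[S] C}
    (h : IsShortExact i p) (hC : IsGorensteinProjective S C) :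
    gorensteinProjectiveDim S A = gorensteinProjectiveDim S B := by
  have : ∀ n, HasGorensteinProjectiveResolution S A n ↔ HasGorensteinProjectiveResolution S B n :=
    fun n => ⟨fun hA => hA.middle h hC, fun hB => hB.left h hC⟩
  simp only [gorensteinProjectiveDim, this]

end Dimension

/-! ### Comparison of presentations -/

section Comparison

variable {S T D : Type u} [Ring S] [Ring T] [AddCommGroup D] [Module S D] [Module T D]
  [SMulCommClass S T D] [SMulCommClass T S D]

/-- Compare a presentation `X₁ → X₀ → A → 0` by finitely generated Gorenstein projective modules
with a presentation `P₁ → P₀ → A → 0` by finitely generated projective modules, by lifting the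
identity of `A` to `P₁ → X₁`, `P₀ → X₀`. If `F → X₁` is a free cover of the kernel of `X₁ → X₀`, the
mapping cone gives an exact sequence `0 → K → P₁ × F → X₁ × P₀ → X₀ → 0`, all of whose kernels are
Gorenstein projective. It remains exact under `Hom(-, D)`, and the dual sequence says that the
cokernel of `X₀* → X₁*` embeds into that of `P₀* → P₁* × F*` with cokernel `K*`. -/
theorem IsDualizingBimodule.exists_shortExact_of_presentations (hD : IsDualizingBimodule S T D)
    {A X₁ X₀ P₁ P₀ M N : Type u}
    [AddCommGroup A] [Module S A] [AddCommGroup X₁] [Module S X₁] [AddCommGroup X₀] [Module S X₀]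
    [AddCommGroup P₁] [Module S P₁] [AddCommGroup P₀] [Module S P₀] [AddCommGroup M] [Module T M]
    [AddCommGroup N] [Module T N] [Module.Finite S X₁] [Module.Finite S X₀] [Module.Finite S P₁]
    [Module.Finite S P₀] [Module.Projective S P₁] [Module.Projective S P₀]
    (hX₁ : IsGorensteinProjective S X₁) (hX₀ : IsGorensteinProjective S X₀)
    {g : X₁ →ₗ[S] X₀} {p : X₀ →ₗ[S] A} (hgp : Function.Exact g p) (hp : Function.Surjective p)
    {f : P₁ →ₗ[S] P₀} {q : P₀ →ₗ[S] A} (hfq : Function.Exact f q) (hq : Function.Surjective q)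
    {m : (X₁ →ₗ[S] D) →ₗ[T] M} (hgm : Function.Exact (LinearMap.lcomp T D g) m)
    (hm : Function.Surjective m)
    {n : (P₁ →ₗ[S] D) →ₗ[T] N} (hfn : Function.Exact (LinearMap.lcomp T D f) n)
    (hn : Function.Surjective n) :
    ∃ (Q H : ModuleCat.{u} T) (i : M →ₗ[T] N × Q) (r : N × Q →ₗ[T] H), Module.Finite T Q ∧
      Module.Projective T Q ∧ Module.Finite T H ∧ IsGorensteinProjective T H ∧
      IsShortExact i r := by
  have := hD.noetherian_left
  have := hD.projective
  obtain ⟨f₀, hf₀⟩ := Module.projective_lifting_property p q hp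
  have hf₀' : ∀ y, p (f₀ y) = q y := LinearMap.congr_fun hf₀
  obtain ⟨f₁, hf₁⟩ := Module.projective_lifting_property g.rangeRestrict
    ((f₀ ∘ₗ f).codRestrict (LinearMap.range g) fun y => (hgp _).1 (by
      change p (f₀ (f y)) = 0
      rw [hf₀', hfq.apply_apply_eq_zero])) g.surjective_rangeRestrict
  have hf₁' : ∀ y, g (f₁ y) = f₀ (f y) := fun y => congrArg Subtype.val (LinearMap.congr_fun hf₁ y)
  obtain ⟨ι, _, k', hk'⟩ := Module.Finite.exists_finite_free_surjective S (LinearMap.ker g)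
  let k : (ι → S) →ₗ[S] X₁ := (LinearMap.ker g).subtype ∘ₗ k'
  have hgk : ∀ z, g (k z) = 0 := fun z => (k' z).2
  have hk : ∀ x, g x = 0 → ∃ z, k z = x := fun x hx => by
    obtain ⟨z, hz⟩ := hk' ⟨x, hx⟩
    exact ⟨z, congrArg Subtype.val hz⟩
  let α : (X₁ × P₀) →ₗ[S] X₀ := g.coprod (-f₀)
  have hα : ∀ x y, α (x, y) = g x - f₀ y := fun x y => by simp [α, sub_eq_add_neg]
  have hαs : Function.Surjective α := fun x => by
    obtain ⟨y, hy⟩ := hq (p x)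
    obtain ⟨z, hz⟩ := (hgp (x - f₀ y)).1 (by rw [map_sub, hf₀', hy, sub_self])
    exact ⟨(z, -y), by rw [hα, hz, map_neg]; abel⟩
  let β : (P₁ × (ι → S)) →ₗ[S] LinearMap.ker α :=
    ((f₁.coprod k).prod (f ∘ₗ LinearMap.fst S P₁ (ι → S))).codRestrict _ fun ⟨y, z⟩ => by
      change α (f₁ y + k z, f y) = 0
      rw [hα, map_add, hf₁', hgk, add_zero, sub_self]
  have hβ : ∀ y z, (β (y, z)).1 = (f₁ y + k z, f y) := fun y z => by simp [β]
  have hβs : Function.Surjective β := by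
    rintro ⟨⟨x, y⟩, hxy⟩
    have hxy' : g x = f₀ y := by rw [← sub_eq_zero, ← hα]; exact hxy
    obtain ⟨w, rfl⟩ := (hfq y).1 (by rw [← hf₀', ← hxy', hgp.apply_apply_eq_zero])
    obtain ⟨z, hz⟩ := hk (x - f₁ w) (by rw [map_sub, hf₁', hxy', sub_self])
    exact ⟨(w, z), Subtype.ext (by rw [hβ, hz, add_sub_cancel])⟩
  have hL : IsGorensteinProjective S (LinearMap.ker α) := .ker hαs (hX₁.prod .of_projective) hX₀
  have hK : IsGorensteinProjective S (LinearMap.ker β) := .ker hβs .of_projective hL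
  have hQ := hD.dual_projective (ι → S)
  -- `i` sends the class of `φ : X₁ → D` to the classes of its restrictions to `P₁` and `F`;
  -- `r` restricts maps `P₁ × F → D` to `K`
  obtain ⟨i, hi⟩ := LinearMap.exists_comp_eq_of_ker_le hm
    ((n ∘ₗ LinearMap.lcomp T D f₁).prod (LinearMap.lcomp T D k)) (by
      intro φ hφ
      obtain ⟨θ, rfl⟩ := (hgm φ).1 hφ
      refine LinearMap.mem_ker.2 (Prod.ext ((hfn _).2 ⟨θ ∘ₗ f₀, ?_⟩) ?_)
      · ext y
        exact congrArg θ (hf₁' y).symm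
      · ext z
        simp [hgk])
  have hi' : ∀ φ, i (m φ) = (n (φ ∘ₗ f₁), φ ∘ₗ k) := LinearMap.congr_fun hi
  obtain ⟨r₁, hr₁⟩ := LinearMap.exists_comp_eq_of_ker_le hn
    (LinearMap.lcomp T D (LinearMap.fst S P₁ (ι → S) ∘ₗ (LinearMap.ker β).subtype)) (by
      intro χ hχ
      obtain ⟨ψ, rfl⟩ := (hfn χ).1 hχ
      rw [LinearMap.mem_ker]
      ext ⟨⟨y, z⟩, hyz⟩
      have h1 : f y = 0 := congrArg (fun w => (Subtype.val w).2) (hyz : β (y, z) = 0)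
      simp [h1])
  have hr₁' : ∀ χ : P₁ →ₗ[S] D, r₁ (n χ) =
      χ ∘ₗ LinearMap.fst S P₁ (ι → S) ∘ₗ (LinearMap.ker β).subtype := LinearMap.congr_fun hr₁
  let r : N × ((ι → S) →ₗ[S] D) →ₗ[T] (LinearMap.ker β →ₗ[S] D) := r₁.coprod
    (LinearMap.lcomp T D (LinearMap.snd S P₁ (ι → S) ∘ₗ (LinearMap.ker β).subtype))
  have hr : ∀ χ ω, r (n χ, ω) = χ.coprod ω ∘ₗ (LinearMap.ker β).subtype := fun χ ω => by
    ext y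
    simp [r, hr₁']
  refine ⟨ModuleCat.of T ((ι → S) →ₗ[S] D), ModuleCat.of T (LinearMap.ker β →ₗ[S] D), i, r, hQ.2,
    hQ.1, hD.dual_finite _, hD.isGorensteinProjective_dual hK, ?_, ?_, ?_⟩
  -- if `φ` restricts to `ψ ∘ f` on `P₁` and to `0` on `F`, then `(φ, -ψ)` vanishes on `ker α`
  · rw [injective_iff_map_eq_zero]
    intro μ hμ
    obtain ⟨φ, rfl⟩ := hm μ
    rw [hi'] at hμ
    have hμ1 : n (φ ∘ₗ f₁) = 0 := congrArg Prod.fst hμ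
    have hμ2 : φ ∘ₗ k = 0 := congrArg Prod.snd hμ
    obtain ⟨ψ, hψ⟩ := (hfn _).1 hμ1
    obtain ⟨θ, hθ⟩ := LinearMap.exists_comp_eq_of_ker_le hαs (φ.coprod (-ψ)) (by
      intro v hv
      obtain ⟨⟨y, z⟩, hyz⟩ := hβs ⟨v, hv⟩
      have h1 : v = (f₁ y + k z, f y) := by rw [← hβ, hyz]
      have h2 : ψ (f y) = φ (f₁ y) := LinearMap.congr_fun hψ y
      have h3 : φ (k z) = 0 := LinearMap.congr_fun hμ2 z
      simp [h1, h2, h3])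
    refine (hgm φ).2 ⟨θ, ?_⟩
    ext x
    have h1 := LinearMap.congr_fun hθ (x, 0)
    simpa [hα] using h1
  · rintro ⟨ν, ω⟩
    obtain ⟨χ, rfl⟩ := hn ν
    change r (n χ, ω) = 0 ↔ _
    rw [hr]
    constructor
    -- a map vanishing on `K` descends to `ker α`, and extends to `X₁ × P₀` as `Ext¹(X₀, D) = 0`
    · intro h
      obtain ⟨l, hl⟩ := (IsShortExact.of_ker hβs).exists_desc (χ.coprod ω) h
      obtain ⟨μ, hμ⟩ := hX₀.extVanish.exists_extension (IsShortExact.of_ker hαs) l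
      have hμ' : ∀ y z, μ (f₁ y + k z, f y) = χ y + ω z := fun y z => by
        have h1 := LinearMap.congr_fun hl (y, z)
        rw [LinearMap.comp_apply, ← hμ, LinearMap.comp_apply, Submodule.subtype_apply, hβ] at h1
        simpa using h1
      refine ⟨m (μ ∘ₗ LinearMap.inl S X₁ P₀), ?_⟩
      rw [hi']
      refine Prod.ext ?_ ?_
      · change n _ = n χ
        rw [← sub_eq_zero, ← map_sub, hfn]
        refine ⟨-(μ ∘ₗ LinearMap.inr S X₁ P₀), ?_⟩
        ext y
        have h1 := hμ' y 0
        have h2 : μ (f₁ y, f y) = μ (f₁ y, 0) + μ (0, f y) := by rw [← map_add]; simp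
        rw [map_zero, map_zero, add_zero, add_zero, h2] at h1
        simp [← h1]
      · ext z
        have h1 := hμ' 0 z
        simpa using h1
    · rintro ⟨μ, hμ⟩
      obtain ⟨φ, rfl⟩ := hm μ
      rw [hi'] at hμ
      rw [← hr, ← hμ, hr]
      ext ⟨⟨y, z⟩, hyz⟩
      have h1 : f₁ y + k z = 0 := congrArg (fun w => (Subtype.val w).1) (hyz : β (y, z) = 0)
      have h2 : φ (f₁ y) + φ (k z) = 0 := by rw [← map_add, h1, map_zero]
      simpa using h2
  · intro κ
    obtain ⟨χ, hχ⟩ := hL.extVanish.exists_extension (IsShortExact.of_ker hβs) κ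
    refine ⟨(n (χ ∘ₗ LinearMap.inl S _ _), χ ∘ₗ LinearMap.inr S _ _), ?_⟩
    rw [hr, ← hχ, LinearMap.coprod_comp_inl_inr]

end Comparison

/-! ### Transposes and Gorenstein transposes -/

section Transposes

variable {S T D : Type u} [Ring S] [Ring T] [AddCommGroup D] [Module S D] [Module T D]
  [SMulCommClass S T D]
variable {A M N : Type u} [AddCommGroup A] [Module S A] [AddCommGroup M] [Module T M]
  [AddCommGroup N] [Module T N]

/-- A module isomorphic to a cokernel, as in the definition of transposes, is the target of an exact
sequence. -/
theorem exact_symm_comp_mkQ {E : Type u} [AddCommGroup E] [Module T E] {U : Submodule T E}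
    (e : M ≃ₗ[T] E ⧸ U) {E' : Type u} [AddCommGroup E'] [Module T E'] {f : E' →ₗ[T] E}
    (hf : LinearMap.range f = U) : Function.Exact f (e.symm.toLinearMap ∘ₗ U.mkQ) := by
  subst hf
  intro x
  simp

theorem IsTranspose.isGorensteinTranspose (h : IsTranspose S T D A N) :
    IsGorensteinTranspose S T D A N := by
  obtain ⟨P₁, P₀, f, p, h1, h2, h3, h4, hfp, hp, e⟩ := h
  exact ⟨P₁, P₀, f, p, h1, h2, .of_projective, .of_projective, hfp, hp, e⟩

theorem exists_isTranspose (T D : Type u) [Ring T] [AddCommGroup D] [Module S D] [Module T D]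
    [SMulCommClass S T D] [IsNoetherianRing S] (A : Type u) [AddCommGroup A] [Module S A]
    [Module.Finite S A] : ∃ N : ModuleCat.{u} T, IsTranspose S T D A N := by
  obtain ⟨ι, _, p, hp⟩ := Module.Finite.exists_finite_free_surjective S A
  obtain ⟨κ, _, k, hk⟩ := Module.Finite.exists_finite_free_surjective S (LinearMap.ker p)
  let f : (κ → S) →ₗ[S] (ι → S) := (LinearMap.ker p).subtype ∘ₗ k
  refine ⟨ModuleCat.of T (((κ → S) →ₗ[S] D) ⧸ LinearMap.range (LinearMap.lcomp T D f)),
    ModuleCat.of S (κ → S), ModuleCat.of S (ι → S), f, p,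
    inferInstanceAs (Module.Finite S (κ → S)), inferInstanceAs (Module.Finite S (ι → S)),
    inferInstanceAs (Module.Projective S (κ → S)), inferInstanceAs (Module.Projective S (ι → S)),
    fun x => ⟨fun hx => ?_, ?_⟩, hp, ⟨LinearEquiv.refl _ _⟩⟩
  · obtain ⟨y, hy⟩ := hk ⟨x, hx⟩
    exact ⟨y, congrArg Subtype.val hy⟩
  · rintro ⟨y, rfl⟩
    exact (k y).2

/-- A Gorenstein projective module has a Gorenstein transpose that is zero, namely the one of the
presentation `0 → A → A → 0`. -/
theorem isGorensteinTranspose_of_subsingleton [Module.Finite S A] (hA : IsGorensteinProjective S A)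
    [Subsingleton M] : IsGorensteinTranspose S T D A M := by
  refine ⟨ModuleCat.of S PUnit.{u + 1}, ModuleCat.of S A, 0, LinearMap.id,
    inferInstanceAs (Module.Finite S PUnit.{u + 1}), inferInstanceAs (Module.Finite S A),
    IsGorensteinProjective.of_projective (A := PUnit.{u + 1}), hA, fun x => ?_,
    Function.surjective_id, ⟨?_⟩⟩
  · exact ⟨fun hx => ⟨0, hx.symm⟩, fun ⟨_, hy⟩ => hy.symm⟩
  · have : Subsingleton (PUnit.{u + 1} →ₗ[S] D) := ⟨fun φ ψ =>
      LinearMap.ext fun x => by rw [Subsingleton.elim x 0, map_zero, map_zero]⟩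
    have h2 : Subsingleton ((PUnit.{u + 1} →ₗ[S] D) ⧸
        LinearMap.range (LinearMap.lcomp T D (0 : PUnit.{u + 1} →ₗ[S] A))) :=
      (Submodule.mkQ_surjective _).subsingleton
    exact (0 : M ≃ₗ[T] ((PUnit.{u + 1} →ₗ[S] D) ⧸
        LinearMap.range (LinearMap.lcomp T D (0 : PUnit.{u + 1} →ₗ[S] A))))

/-- Adding a projective summand to a module does not change its transposes. -/
theorem IsTranspose.prod_projective (h : IsTranspose S T D A N) (Q : Type u) [AddCommGroup Q]
    [Module S Q] [Module.Finite S Q] [Module.Projective S Q] :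
    IsTranspose S T D (A × Q) N := by
  obtain ⟨P₁, P₀, f, p, h1, h2, h3, h4, hfp, hp, ⟨e⟩⟩ := h
  refine ⟨P₁, ModuleCat.of S (P₀ × Q), LinearMap.inl S P₀ Q ∘ₗ f, p.prodMap LinearMap.id, h1,
    inferInstanceAs (Module.Finite S (P₀ × Q)), h3, inferInstanceAs (Module.Projective S (P₀ × Q)),
    ?_, hp.prodMap Function.surjective_id, ⟨e.trans (Submodule.quotEquivOfEq _ _ ?_)⟩⟩
  · rintro ⟨x, y⟩
    constructor
    · intro hxy
      obtain rfl : y = 0 := congrArg Prod.snd hxy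
      obtain ⟨z, rfl⟩ := (hfp x).1 (congrArg Prod.fst hxy)
      exact ⟨z, rfl⟩
    · rintro ⟨z, hz⟩
      obtain rfl : f z = x := congrArg Prod.fst hz
      obtain rfl : 0 = y := congrArg Prod.snd hz
      exact Prod.ext (hfp.apply_apply_eq_zero z) rfl
  · ext φ
    constructor
    · rintro ⟨ψ, rfl⟩
      exact ⟨ψ ∘ₗ LinearMap.fst S P₀ Q, by ext; simp⟩
    · rintro ⟨ψ, rfl⟩
      exact ⟨ψ ∘ₗ LinearMap.inl S P₀ Q, rfl⟩

namespace IsDualizingBimodule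

variable (hD : IsDualizingBimodule S T D)
include hD

theorem finite_of_isGorensteinTranspose (h : IsGorensteinTranspose S T D A M) :
    Module.Finite T M := by
  obtain ⟨X₁, X₀, g, p, h1, h2, -, -, -, -, ⟨e⟩⟩ := h
  have := hD.dual_finite X₁
  exact Module.Finite.equiv e.symm

/-- A transpose of `B` is a Gorenstein transpose of the kernel of any epimorphism from `B` to a
Gorenstein projective module `C`: a presentation `P₁ → P₀ → B → 0` restricts to a
presentation `P₁ → ker (P₀ → C) → A → 0`, and every map `ker (P₀ → C) → D` extends to `P₀`. -/
theorem isGorensteinTranspose_left {B C : Type u} [AddCommGroup B] [Module S B] [AddCommGroup C]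
    [Module S C] {i : A →ₗ[S] B} {r : B →ₗ[S] C} (h : IsShortExact i r)
    (hC : IsGorensteinProjective S C) (hN : IsTranspose S T D B N) :
    IsGorensteinTranspose S T D A N := by
  obtain ⟨P₁, P₀, f, p, h1, h2, h3, h4, hfp, hp, ⟨e⟩⟩ := hN
  have := hD.noetherian_left
  have := hD.projective
  have hrp : Function.Surjective (r ∘ₗ p) := h.surjective.comp hp
  obtain ⟨ψ, hψ⟩ := LinearMap.exists_comp_eq_of_range_le h.injective
    (p ∘ₗ (LinearMap.ker (r ∘ₗ p)).subtype) (by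
      rintro _ ⟨x, rfl⟩
      exact (h.exact _).1 x.2)
  have hψ' : ∀ x, i (ψ x) = p x.1 := LinearMap.congr_fun hψ
  let g : P₁ →ₗ[S] LinearMap.ker (r ∘ₗ p) := f.codRestrict _ fun x => by
    simp [hfp.apply_apply_eq_zero]
  refine ⟨P₁, ModuleCat.of S (LinearMap.ker (r ∘ₗ p)), g, ψ, h1,
    inferInstanceAs (Module.Finite S (LinearMap.ker (r ∘ₗ p))), .of_projective,
    .ker hrp .of_projective hC, fun x => ?_, fun a => ?_,
    ⟨e.trans (Submodule.quotEquivOfEq _ _ ?_)⟩⟩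
  · rw [← map_eq_zero_iff i h.injective, hψ', hfp]
    exact ⟨fun ⟨y, hy⟩ => ⟨y, Subtype.ext hy⟩, fun ⟨y, hy⟩ => ⟨y, congrArg Subtype.val hy⟩⟩
  · obtain ⟨x, hx⟩ := hp (i a)
    exact ⟨⟨x, by simp [hx, h.exact.apply_apply_eq_zero]⟩, h.injective ((hψ' _).trans hx)⟩
  · ext φ
    constructor
    · rintro ⟨θ, rfl⟩
      exact ⟨θ ∘ₗ (LinearMap.ker (r ∘ₗ p)).subtype, rfl⟩
    · rintro ⟨θ, rfl⟩
      obtain ⟨χ, rfl⟩ := hC.extVanish.exists_extension (IsShortExact.of_ker hrp) θ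
      exact ⟨χ, rfl⟩

variable [SMulCommClass T S D]

/-- A Gorenstein transpose embeds into any transpose of the same module, up to a projective
summand, with Gorenstein projective cokernel. -/
theorem exists_shortExact (hM : IsGorensteinTranspose S T D A M) (hN : IsTranspose S T D A N) :
    ∃ (Q H : ModuleCat.{u} T) (i : M →ₗ[T] N × Q) (r : N × Q →ₗ[T] H), Module.Finite T Q ∧
      Module.Projective T Q ∧ Module.Finite T H ∧ IsGorensteinProjective T H ∧
      IsShortExact i r := by
  obtain ⟨X₁, X₀, g, p, h1, h2, hX₁, hX₀, hgp, hp, ⟨e⟩⟩ := hM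
  obtain ⟨P₁, P₀, f, q, h3, h4, h5, h6, hfq, hq, ⟨e'⟩⟩ := hN
  exact hD.exists_shortExact_of_presentations hX₁ hX₀ hgp hp hfq hq (exact_symm_comp_mkQ e rfl)
    (e.symm.surjective.comp (Submodule.mkQ_surjective _)) (exact_symm_comp_mkQ e' rfl)
    (e'.symm.surjective.comp (Submodule.mkQ_surjective _))

theorem extIso (hM : IsGorensteinTranspose S T D A M) (hN : IsTranspose S T D A N) {n : ℕ}
    (hn : 1 ≤ n) : ExtIso T S D M N n := by
  obtain ⟨Q, H, i, r, -, hQ, -, hH, h⟩ := hD.exists_shortExact hM hN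
  have := hD.symm.projective
  exact (h.extIso hH.extVanish hn).symm.trans
    ((IsShortExact.prod T N Q).extIso ExtVanish.of_projective hn)

theorem gorensteinProjectiveDim_eq (hM : IsGorensteinTranspose S T D A M)
    (hN : IsTranspose S T D A N) : gorensteinProjectiveDim T M = gorensteinProjectiveDim T N := by
  obtain ⟨Q, H, i, r, -, hQ, -, hH, h⟩ := hD.exists_shortExact hM hN
  exact (h.gorensteinProjectiveDim_eq hH).trans
    ((IsShortExact.prod T N Q).gorensteinProjectiveDim_eq .of_projective).symm

theorem isGorensteinProjective_iff (hM : IsGorensteinTranspose S T D A M)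
    (hN : IsTranspose S T D A N) : IsGorensteinProjective T M ↔ IsGorensteinProjective T N := by
  obtain ⟨Q, H, i, r, -, hQ, -, hH, h⟩ := hD.exists_shortExact hM hN
  exact ⟨fun h' => .left (IsShortExact.prod T N Q) (.middle h h' hH) .of_projective,
    fun h' => .left h (h'.prod .of_projective) hH⟩

/-- Torsionfreeness can be tested on a single Gorenstein transpose. -/
theorem isTorsionfree_iff (hM : IsGorensteinTranspose S T D A M) (n : ℕ) :
    IsTorsionfree S T D n A ↔
      Module.Finite S A ∧ ∀ i, 1 ≤ i → i ≤ n → Subsingleton (ExtGroup T D M i) := by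
  have := hD.noetherian_left
  refine and_congr_right fun hA => ⟨fun h i hi hin => ?_, fun h B _ _ hB i hi hin => ?_⟩
  · obtain ⟨N, hN⟩ := exists_isTranspose (S := S) T D A
    exact (hD.extIso hM hN hi).subsingleton_iff.2 (h N hN i hi hin)
  · exact (hD.extIso hM hB hi).subsingleton_iff.1 (h i hi hin)

/-- Transposition is an involution, because finitely generated projective modules are reflexive. -/
theorem isTranspose_symm (hN : IsTranspose S T D A N) : IsTranspose T S D N A := by
  obtain ⟨P₁, P₀, f, p, h1, h2, h3, h4, hfp, hp, ⟨e⟩⟩ := hN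
  have h5 := hD.dual_projective P₁
  have h6 := hD.dual_projective P₀
  let U := LinearMap.range (LinearMap.lcomp S D (LinearMap.lcomp T D f))
  have hU : ∀ x, U.mkQ (evalBidual S T D P₀ x) = 0 ↔ p x = 0 := fun x => by
    rw [hfp x, Submodule.mkQ_apply, Submodule.Quotient.mk_eq_zero]
    constructor
    · rintro ⟨η, hη⟩
      obtain ⟨y, rfl⟩ := (hD.evalBidual_bijective_of_projective P₁).2 η
      exact ⟨y, (hD.evalBidual_bijective_of_projective P₀).1 hη⟩
    · rintro ⟨y, rfl⟩
      exact ⟨evalBidual S T D P₁ y, rfl⟩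
  obtain ⟨ψ, hψ⟩ := LinearMap.exists_comp_eq_of_ker_le hp (U.mkQ ∘ₗ evalBidual S T D P₀)
    fun x hx => (hU x).2 hx
  have hψ' : ∀ x, ψ (p x) = U.mkQ (evalBidual S T D P₀ x) := LinearMap.congr_fun hψ
  refine ⟨ModuleCat.of T (P₀ →ₗ[S] D), ModuleCat.of T (P₁ →ₗ[S] D), LinearMap.lcomp T D f, _,
    h6.2, h5.2, h6.1, h5.1, exact_symm_comp_mkQ e rfl,
    e.symm.surjective.comp (Submodule.mkQ_surjective _),
    ⟨LinearEquiv.ofBijective ψ ⟨?_, fun z => ?_⟩⟩⟩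
  · rw [injective_iff_map_eq_zero]
    intro a ha
    obtain ⟨x, rfl⟩ := hp a
    rwa [hψ', hU] at ha
  · obtain ⟨η, rfl⟩ := U.mkQ_surjective z
    obtain ⟨x, rfl⟩ := (hD.evalBidual_bijective_of_projective P₀).2 η
    exact ⟨p x, hψ' x⟩

/-- If `A` is Gorenstein projective, its transposes can be compared with the Gorenstein transpose
`0` of `A`. Conversely, `A` is a transpose of each of its transposes. -/
theorem isGorensteinProjective_transpose_iff [Module.Finite S A] (hN : IsTranspose S T D A N) :
    IsGorensteinProjective T N ↔ IsGorensteinProjective S A := by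
  have key : ∀ {S T : Type u} [Ring S] [Ring T] [Module S D] [Module T D] [SMulCommClass S T D]
      [SMulCommClass T S D] {A N : Type u} [AddCommGroup A] [Module S A] [AddCommGroup N]
      [Module T N] [Module.Finite S A], IsDualizingBimodule S T D → IsTranspose S T D A N →
      IsGorensteinProjective S A → IsGorensteinProjective T N := by
    intro S T _ _ _ _ _ _ A N _ _ _ _ _ hD hN hA
    exact (hD.isGorensteinProjective_iff (M := PUnit.{u + 1})
      (isGorensteinTranspose_of_subsingleton hA) hN).1 .of_projective
  have := hD.finite_of_isGorensteinTranspose hN.isGorensteinTranspose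
  exact ⟨key hD.symm (hD.isTranspose_symm hN), key hD hN⟩

/-- A transpose `B` of `N` is also a transpose of `N × Q` for `Q` projective, hence a Gorenstein
transpose of the submodule `M` of `N × Q`. So the same groups `Ext(B, D)` decide
whether `M` and `N` are torsionfree. -/
theorem isTorsionfree_congr (hM : IsGorensteinTranspose S T D A M) (hN : IsTranspose S T D A N)
    (n : ℕ) : IsTorsionfree T S D n M ↔ IsTorsionfree T S D n N := by
  have := hD.noetherian_right
  have hMf := hD.finite_of_isGorensteinTranspose hM
  have hNf := hD.finite_of_isGorensteinTranspose hN.isGorensteinTranspose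
  obtain ⟨Q, H, i, r, hQf, hQp, -, hH, h⟩ := hD.exists_shortExact hM hN
  obtain ⟨B, hB⟩ := exists_isTranspose (S := T) S D N
  rw [hD.symm.isTorsionfree_iff (hD.symm.isGorensteinTranspose_left h hH (hB.prod_projective Q)),
    hD.symm.isTorsionfree_iff hB.isGorensteinTranspose]
  exact and_congr_left fun _ => iff_of_true hMf hNf

end IsDualizingBimodule

end Transposes
theorem proposition3p4 {R : Type u} [Ring R] [IsNoetherianRing R] [IsNoetherianRing Rᵐᵒᵖ]
    (A : Type u) [AddCommGroup A] [Module R A] [Module.Finite R A] :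
    (∀ (M N : Type u) [AddCommGroup M] [Module Rᵐᵒᵖ M] [AddCommGroup N] [Module Rᵐᵒᵖ N],
      IsGorensteinTranspose R Rᵐᵒᵖ R A M → IsTranspose R Rᵐᵒᵖ R A N →
        (∀ i : ℕ, 1 ≤ i → ExtIso Rᵐᵒᵖ R R M N i) ∧
        (∀ n : ℕ, 1 ≤ n → (IsTorsionfree Rᵐᵒᵖ R R n M ↔ IsTorsionfree Rᵐᵒᵖ R R n N)) ∧
        gorensteinProjectiveDim Rᵐᵒᵖ M = gorensteinProjectiveDim Rᵐᵒᵖ N) ∧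
    ((∃ (M : Type u) (_ : AddCommGroup M) (_ : Module Rᵐᵒᵖ M),
        IsGorensteinTranspose R Rᵐᵒᵖ R A M ∧ Subsingleton M) ↔ IsGorensteinProjective R A) ∧
    (IsGorensteinProjective R A ↔
      ∀ (M : Type u) [AddCommGroup M] [Module Rᵐᵒᵖ M],
        IsGorensteinTranspose R Rᵐᵒᵖ R A M → IsGorensteinProjective Rᵐᵒᵖ M) ∧
    (IsGorensteinProjective R A ↔
      ∀ (N : Type u) [AddCommGroup N] [Module Rᵐᵒᵖ N],
        IsTranspose R Rᵐᵒᵖ R A N → IsGorensteinProjective Rᵐᵒᵖ N) := by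

  have hD := isDualizingBimodule_self R
  obtain ⟨N₀, hN₀⟩ := exists_isTranspose (S := R) Rᵐᵒᵖ R A
  have hN₀A := hD.isGorensteinProjective_transpose_iff hN₀
  refine ⟨fun M N _ _ _ _ hM hN => ⟨fun i hi => hD.extIso hM hN hi,
    fun n _ => hD.isTorsionfree_congr hM hN n, hD.gorensteinProjectiveDim_eq hM hN⟩,
    ⟨?_, fun hA => ?_⟩, ⟨fun hA M _ _ hM => ?_, fun h => ?_⟩, ⟨fun hA N _ _ hN => ?_, fun h => ?_⟩⟩
  · rintro ⟨M, _, _, hM, _⟩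
    exact hN₀A.1 ((hD.isGorensteinProjective_iff hM hN₀).1 .of_projective)
  · exact ⟨PUnit, inferInstance, inferInstance, isGorensteinTranspose_of_subsingleton hA,
      inferInstance⟩
  · exact (hD.isGorensteinProjective_iff hM hN₀).2 (hN₀A.2 hA)
  · exact hN₀A.1 (h N₀ hN₀.isGorensteinTranspose)
  · exact (hD.isGorensteinProjective_transpose_iff hN).2 hA
  · exact hN₀A.1 (h N₀ hN₀)
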